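/- Let $n\ge 0$ be an integer and let $\mathbb T^n=\mathbb R^n/\mathbb Z^n$ be the flat torus with Lebesgue measure $dx$. Let $f:\mathbb T^n\times\mathbb T^n\to\mathbb R$ be of class $C^2$. For Borel probability measures $\mu,\nu$ on $\mathbb T^n$ put $$F(\mu,\nu)=\iint f(x,y)\,d\mu(x)\,d\nu(y)+H(\mu)-H(\nu),$$ where $H(\mu)=\int\log\bigl(\tfrac{d\mu}{dx}\bigr)\,d\mu\in(-\infty,\infty]$ if $\mu\ll dx$ and $H(\mu)=\infty$ otherwise. A pair $(\mu^*,\nu^*)$ of Borel probability measures is a mixed Nash equilibrium (MNE) if $F(\mu^*,\nu)\le F(\mu^*,\nu^*)\le F(\mu,\nu^*)$ for all Borel probability measures $\mu,\nu$ on $\mathbb T^n$. There is a constant $\lambda_{gap}=\lambda_{gap}(f)>0$, depending only on $f$, such that for every MNE $(\mu^*,\nu^*)$ (it is in fact unique), for every $p\in(n,\infty]$ and for all functions $\phi,\psi$ on $\mathbb T^n$ whose weak gradients $\nabla\phi,\nabla\psi$ belong to the Sobolev space $W^{2,p}(\mathbb T^n;\mathbb R^n)$, the following holds. The integrals $\int|\nabla\phi|^2\,d\mu^*$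 and $\int|\nabla\psi|^2\,d\nu^*$ are finite; the functions $t\mapsto F((id+t\nabla\phi)_\#\mu^*,\nu^*)$ and $t\mapsto F(\mu^*,(id+t\nabla\psi)_\#\nu^*)$ are finite and differentiable near $t=0$ and twice differentiable at $t=0$; and $$\frac{d^2}{dt^2}\Big|_{t=0}F\bigl((id+t\nabla\phi)_\#\mu^*,\nu^*\bigr)\ \ge\ \lambda_{gap}\int|\nabla\phi|^2\,d\mu^*,$$ $$\frac{d^2}{dt^2}\Big|_{t=0}F\bigl(\mu^*,(id+t\nabla\psi)_\#\nu^*\bigr)\ \le\ -\lambda_{gap}\int|\nabla\psi|^2\,d\nu^*.$$ -/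

import Mathlib

open MeasureTheory Filter Topology
open scoped ENNReal ContDiff

noncomputable section

namespace SpectralGap

/-- Euclidean space `ℝⁿ`. -/
abbrev Vec (n : ℕ) : Type := EuclideanSpace ℝ (Fin n)

/-- The flat torus `ℝⁿ / ℤⁿ`. Its `volume` is Lebesgue measure, of total mass `1`. -/
abbrev Torus (n : ℕ) : Type := UnitAddTorus (Fin n)

/-- The quotient map `ℝⁿ → ℝⁿ / ℤⁿ`. -/
def proj {n : ℕ} (x : Vec n) : Torus n := fun i => ((x i : ℝ) : UnitAddCircle)

/-- A real function on the torus is smooth if its periodic lift to `ℝⁿ` is. -/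
def Smooth {n : ℕ} (u : Torus n → ℝ) : Prop :=
  ContDiff ℝ ∞ (fun x : Vec n => u (proj x))

/-- A payoff on `𝕋ⁿ × 𝕋ⁿ` is `C²` if its periodic lift to `ℝⁿ × ℝⁿ` is. -/
def PayoffC2 {n : ℕ} (f : Torus n → Torus n → ℝ) : Prop :=
  ContDiff ℝ 2 (fun z : Vec n × Vec n => f (proj z.1) (proj z.2))

/-- The classical partial derivative `∂ᵢ u` on the torus. -/
def partialDeriv {n : ℕ} (i : Fin n) (u : Torus n → ℝ) (x : Torus n) : ℝ :=
  deriv (fun s : ℝ => u (x + proj (s • EuclideanSpace.single i (1 : ℝ)))) 0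

/-- The iterated partial derivative `∂_{i₁} ⋯ ∂_{iₘ} u` for `l = [i₁, …, iₘ]`. On smooth functions
it only depends on the multi-index that counts the occurrences of each index in `l`. -/
def iterPartial {n : ℕ} (l : List (Fin n)) (u : Torus n → ℝ) : Torus n → ℝ :=
  l.foldr partialDeriv u

/-- `v` is the weak derivative of `u` for the iterated partial derivative given by `l`. -/
structure HasWeakDeriv {n : ℕ} (l : List (Fin n)) (u v : Torus n → ℝ) : Prop where
  integrable_left : Integrable u
  integrable_right : Integrable v
  integral_eq : ∀ ζ : Torus n → ℝ, Smooth ζ →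
    ∫ x, u x * iterPartial l ζ x = (-1 : ℝ) ^ l.length * ∫ x, v x * ζ x

/-- Membership in the Sobolev space `W^{k,p}(𝕋ⁿ)`: all weak derivatives of order at most `k` exist
and lie in `L^p`. -/
def MemSobolev {n : ℕ} (k : ℕ) (p : ℝ≥0∞) (u : Torus n → ℝ) : Prop :=
  ∀ l : List (Fin n), l.length ≤ k → ∃ v : Torus n → ℝ, MemLp v p ∧ HasWeakDeriv l u v

/-- `Φ` is the weak gradient of the function `φ` on the torus. -/
def IsWeakGradient {n : ℕ} (φ : Torus n → ℝ) (Φ : Torus n → Vec n) : Prop :=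
  Integrable φ ∧ ∀ i, HasWeakDeriv [i] φ (fun x => Φ x i)

/-- `Φ` is (a representative of) a gradient field `∇φ` on the torus with `∇φ ∈ W^{2,p}`. -/
def IsGradientW2 {n : ℕ} (p : ℝ≥0∞) (Φ : Torus n → Vec n) : Prop :=
  (∃ φ : Torus n → ℝ, IsWeakGradient φ Φ) ∧ ∀ i, MemSobolev 2 p (fun x => Φ x i)

open Classical in
/-- `H(μ) = ∫ log (dμ/dx) dμ` if `μ ≪ dx`, and `H(μ) = ∞` otherwise. The negative part of
`log (dμ/dx)` is always `μ`-integrable (since `r log r ≥ -1/e`), so that the integral is `∞` where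
the integrand is not integrable. -/
def entropy {n : ℕ} (μ : Measure (Torus n)) : EReal :=
  if μ ≪ volume ∧ Integrable (fun x => Real.log (μ.rnDeriv volume x).toReal) μ then
    ((∫ x, Real.log (μ.rnDeriv volume x).toReal ∂μ : ℝ) : EReal)
  else ⊤

/-- The entropy-regularized payoff `F(μ,ν) = ∬ f dμ dν + H(μ) - H(ν)`. -/
def energy {n : ℕ} (f : Torus n → Torus n → ℝ) (μ ν : Measure (Torus n)) : EReal :=
  ((∫ x, ∫ y, f x y ∂ν ∂μ : ℝ) : EReal) + entropy μ - entropy ν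

/-- Mixed Nash equilibria of `F`. -/
structure IsMNE {n : ℕ} (f : Torus n → Torus n → ℝ) (μ ν : Measure (Torus n)) : Prop where
  prob_left : IsProbabilityMeasure μ
  prob_right : IsProbabilityMeasure ν
  le_left : ∀ ν' : Measure (Torus n), IsProbabilityMeasure ν' → energy f μ ν' ≤ energy f μ ν
  le_right : ∀ μ' : Measure (Torus n), IsProbabilityMeasure μ' → energy f μ ν ≤ energy f μ' ν

/-- The push-forward `(id + t Φ)_# μ`. -/
def displace {n : ℕ} (t : ℝ) (Φ : Torus n → Vec n) (μ : Measure (Torus n)) : Measure (Torus n) :=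
  μ.map (fun x => x + proj (t • Φ x))

/-- The extended-real function `G` is finite near `t₀`, differentiable near `t₀`, and its
derivative is differentiable at `t₀` with derivative `d`. -/
def HasSecondDerivAt (G : ℝ → EReal) (d t₀ : ℝ) : Prop :=
  ∃ g g' : ℝ → ℝ, (∀ᶠ t in 𝓝 t₀, G t = (g t : EReal)) ∧
    (∀ᶠ t in 𝓝 t₀, HasDerivAt g (g' t) t) ∧ HasDerivAt g' d t₀

end SpectralGap

end

noncomputable section

namespace SpectralGap

variable {n : ℕ}

/-! At an equilibrium each player minimises a linear functional plus entropy, so both measures are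
Gibbs (`eq_gibbs_of_forall_le`): `μ ∝ exp (-U)` with `U = ∫ f dν`, and `ν ∝ exp V` with `V = ∫ f
dμ`. These potentials are `C²` and bounded by `M = sup |f|`, whatever the equilibrium. It therefore
suffices to treat one Gibbs weight `exp (-W)`, with `W = U` or `W = -V`; this is `second_variation`.

Write `G = ∇φ` and `A = DG`. The change of variables `x ↦ x + t G(x)` gives `H((id + tG)_# μ) = H(μ)
- ∫ log det (1 + tA) dμ`, so the second derivative of `∫ W + H` at `0` is `∫ (tr A² + D²W[G, G])
dμ`. By the Bochner identity (`HasGrad.bochner`) this equals `∫ (Lφ)² dμ` for `Lφ = Δφ - ∇W·∇φ`.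
Since `∫ |∇φ|² dμ = -∫ (φ - c) Lφ dμ`, a Poincaré inequality with constant `1/λ` yields `∫ (Lφ)² dμ
≥ λ ∫ |∇φ|² dμ` (`HasGrad.spectral_gap`). The Poincaré inequality is elementary on the flat torus
and passes to the weight at the cost of a factor `exp (2M)`, whence `λ = exp (-2M) / (n + 1)`.

Two points of regularity remain. Morrey's embedding (`exists_continuous_ae_eq`) makes `∇φ ∈
W^{2,p}`, `p > n`, a `C¹` field, so everything can be done classically. The usual proof of Bochner's
identity would need third derivatives of `φ`; they are avoided by the symmetry `∫ ∂ⱼu ∂ᵢw = ∫ ∂ᵢu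
∂ⱼw`, valid for `C¹` functions. -/

/-! ### The torus as a quotient of `ℝⁿ`, and the unit cube. -/

instance isProbabilityMeasure_volume_torus :
    IsProbabilityMeasure (volume : Measure (Torus n)) := by
  have : IsProbabilityMeasure (volume : Measure UnitAddCircle) := ⟨UnitAddCircle.measure_univ⟩
  rw [volume_pi]
  infer_instance

theorem proj_add (x y : Vec n) : proj (x + y) = proj x + proj y := by
  ext i; simp [proj]

@[simp]
theorem proj_zero : proj (0 : Vec n) = 0 := by
  ext i; simp [proj]

theorem proj_neg (x : Vec n) : proj (-x) = -proj x := by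
  ext i; simp [proj]

theorem isOpenQuotientMap_proj : IsOpenQuotientMap (proj : Vec n → Torus n) := by
  have h : IsOpenQuotientMap (Pi.map fun (_ : Fin n) (t : ℝ) => (t : UnitAddCircle)) :=
    IsOpenQuotientMap.piMap fun _ => QuotientAddGroup.isOpenQuotientMap_mk
  exact h.comp (EuclideanSpace.equiv (Fin n) ℝ).toHomeomorph.isOpenQuotientMap

theorem continuous_proj : Continuous (proj : Vec n → Torus n) :=
  isOpenQuotientMap_proj.continuous

theorem continuous_of_comp_proj {X : Type*} [TopologicalSpace X] {u : Torus n → X}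
    (h : Continuous fun x : Vec n => u (proj x)) : Continuous u :=
  isOpenQuotientMap_proj.isQuotientMap.continuous_iff.2 h

/-- The half-open unit cube. -/
def cube (n : ℕ) : Set (Vec n) := {x | ∀ i, x i ∈ Set.Ico (0 : ℝ) 1}

theorem measurableSet_cube : MeasurableSet (cube n) := by
  have : cube n = ⋂ i, (fun x : Vec n => x i) ⁻¹' Set.Ico (0 : ℝ) 1 := by
    ext x; simp [cube]
  rw [this]
  exact MeasurableSet.iInter fun i => (by fun_prop : Measurable fun x : Vec n => x i) measurableSet_Ico

/-- The bridge between integrals on the torus and on `ℝⁿ`: the change of variables and Morrey's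
estimate are both computed on the cube. -/
theorem measurePreserving_proj :
    MeasurePreserving (proj : Vec n → Torus n) (volume.restrict (cube n)) volume := by
  have h1 : MeasurePreserving (fun t : ℝ => (t : UnitAddCircle))
      (volume.restrict (Set.Ico (0 : ℝ) 1)) volume := by
    have := UnitAddCircle.measurePreserving_mk 0
    rwa [zero_add, ← Measure.restrict_congr_set Ico_ae_eq_Ioc] at this
  have h2 := measurePreserving_pi (fun _ : Fin n => (volume : Measure ℝ).restrict (Set.Ico (0 : ℝ) 1))
    (fun _ : Fin n => (volume : Measure UnitAddCircle)) (fun _ => h1)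
  rw [← Measure.restrict_pi_pi, ← volume_pi] at h2
  have h3 := (PiLp.volume_preserving_ofLp (Fin n)).restrict_preimage
    (s := Set.univ.pi fun _ : Fin n => Set.Ico (0 : ℝ) 1)
    (MeasurableSet.univ_pi fun _ => measurableSet_Ico)
  have h4 : (WithLp.ofLp ⁻¹' (Set.univ.pi fun _ : Fin n => Set.Ico (0 : ℝ) 1) : Set (Vec n)) =
      cube n := by
    ext x; simp [cube]
  rw [h4] at h3
  exact h2.comp h3

instance isProbabilityMeasure_restrict_cube :
    IsProbabilityMeasure ((volume : Measure (Vec n)).restrict (cube n)) :=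
  ⟨by
    have h := measurePreserving_proj (n := n).measure_preimage (s := Set.univ) nullMeasurableSet_univ
    rw [Set.preimage_univ] at h
    rw [h, measure_univ]⟩

theorem exists_mem_cube_proj_eq (x : Torus n) : ∃ y ∈ cube n, proj y = x := by
  obtain ⟨y, rfl⟩ := isOpenQuotientMap_proj.surjective x
  refine ⟨WithLp.toLp 2 fun i => Int.fract (y i), fun i => ⟨Int.fract_nonneg _, Int.fract_lt_one _⟩, ?_⟩
  ext i
  simp only [proj]
  rw [← sub_eq_zero, ← AddCircle.coe_sub, AddCircle.coe_eq_zero_iff]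
  exact ⟨-⌊y i⌋, by simp⟩

/-! ### Integration over compact spaces. -/

theorem integrable_of_continuous {X : Type*} [TopologicalSpace X] [CompactSpace X]
    [MeasurableSpace X] [BorelSpace X] {μ : Measure X} [IsFiniteMeasure μ] {h : X → ℝ}
    (hh : Continuous h) : Integrable h μ :=
  hh.integrable_of_hasCompactSupport (HasCompactSupport.of_compactSpace h)

/-- Differentiation under the integral sign over a compact space. -/
theorem hasDerivAt_integral_mul_of_continuousOn {X : Type*} [TopologicalSpace X] [CompactSpace X]
    [MeasurableSpace X] [BorelSpace X] {μ : Measure X} {w : X → ℝ}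
    (hw : Integrable w μ) {K K' : ℝ → X → ℝ} {O : Set ℝ} (hO : IsOpen O)
    (hK : ∀ t ∈ O, Continuous (K t))
    (hK' : ContinuousOn (fun z : ℝ × X => K' z.1 z.2) (O ×ˢ Set.univ))
    (hd : ∀ t ∈ O, ∀ x, HasDerivAt (fun s => K s x) (K' t x) t) {t : ℝ} (ht : t ∈ O) :
    HasDerivAt (fun s => ∫ x, w x * K s x ∂μ) (∫ x, w x * K' t x ∂μ) t := by
  obtain ⟨ε, hε, hεO⟩ := Metric.isOpen_iff.1 hO t ht
  have hsub : Metric.closedBall t (ε / 2) ⊆ O :=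
    (Metric.closedBall_subset_ball (by linarith)).trans hεO
  obtain ⟨C, hC⟩ := ((isCompact_closedBall t (ε / 2)).prod
    (isCompact_univ (X := X))).exists_bound_of_continuousOn
    (hK'.mono (Set.prod_mono hsub subset_rfl))
  have hc : ∀ s ∈ O, Continuous (K' s) := fun s hs => by
    have := hK'.comp_continuous (f := fun x : X => (s, x)) (by fun_prop) (fun x => ⟨hs, trivial⟩)
    exact this
  have hmeas : ∀ {h : X → ℝ}, Continuous h → AEStronglyMeasurable h μ := fun hh =>
    hh.stronglyMeasurable_of_hasCompactSupport
      (HasCompactSupport.of_compactSpace _) |>.aestronglyMeasurable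
  obtain ⟨B, hB⟩ := (isCompact_univ (X := X)).exists_bound_of_continuousOn (hK t ht).continuousOn
  refine (hasDerivAt_integral_of_dominated_loc_of_deriv_le (bound := fun x => ‖w x‖ * C)
    (Metric.closedBall_mem_nhds t (half_pos hε))
    (hO.eventually_mem ht |>.mono fun s hs => hw.aestronglyMeasurable.mul (hmeas (hK s hs)))
    (hw.mul_bdd (c := B) (hmeas (hK t ht)) (.of_forall fun x => hB x trivial))
    (hw.aestronglyMeasurable.mul (hmeas (hc t ht)))
    (.of_forall fun x s hs => ?_) (hw.norm.mul_const C)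
    (.of_forall fun x s hs => (hd s (hsub hs) x).const_mul (w x))).2
  rw [norm_mul]
  exact mul_le_mul_of_nonneg_left (hC (s, x) ⟨hs, trivial⟩) (norm_nonneg _)

theorem hasDerivAt_integral_of_continuousOn {X : Type*} [TopologicalSpace X] [CompactSpace X]
    [MeasurableSpace X] [BorelSpace X] {μ : Measure X} [IsFiniteMeasure μ]
    {K K' : ℝ → X → ℝ} {O : Set ℝ} (hO : IsOpen O)
    (hK : ∀ t ∈ O, Continuous (K t))
    (hK' : ContinuousOn (fun z : ℝ × X => K' z.1 z.2) (O ×ˢ Set.univ))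
    (hd : ∀ t ∈ O, ∀ x, HasDerivAt (fun s => K s x) (K' t x) t) {t : ℝ} (ht : t ∈ O) :
    HasDerivAt (fun s => ∫ x, K s x ∂μ) (∫ x, K' t x ∂μ) t := by
  simpa using hasDerivAt_integral_mul_of_continuousOn (μ := μ) (w := fun _ => 1)
    (integrable_const _) hO hK hK' hd ht

/-! ### Calculus of `C¹` functions on the torus. -/

/-- `g` is the continuous gradient of the function `u` on the torus. -/
structure HasGrad (u : Torus n → ℝ) (g : Fin n → Torus n → ℝ) : Prop where
  continuous : Continuous u
  continuous_grad : ∀ i, Continuous (g i)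
  hasDerivAt_zero : ∀ (x : Torus n) (v : Vec n),
    HasDerivAt (fun t : ℝ => u (x + proj (t • v))) (∑ i, v i * g i x) 0

namespace HasGrad

variable {u w : Torus n → ℝ} {g k : Fin n → Torus n → ℝ}

/-- Moving the base point along the line reduces any `t` to `0`, which is why the structure records
derivatives at `0` only. -/
theorem hasDerivAt (h : HasGrad u g) (x : Torus n) (v : Vec n) (t : ℝ) :
    HasDerivAt (fun t : ℝ => u (x + proj (t • v))) (∑ i, v i * g i (x + proj (t • v))) t := by
  have h0 := h.hasDerivAt_zero (x + proj (t • v)) v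
  have h1 : HasDerivAt (fun s : ℝ => s - t) 1 t := (hasDerivAt_id t).sub_const t
  have h2 := HasDerivAt.comp t (h₂ := fun s : ℝ => u (x + proj (t • v) + proj (s • v)))
    (by rwa [sub_self]) h1
  rw [mul_one] at h2
  refine h2.congr_of_eventuallyEq (.of_forall fun s => ?_)
  simp [add_assoc, ← proj_add, ← add_smul]

theorem of_hasDerivAt_lift (hc : ∀ i, Continuous (g i)) (hu : Continuous u)
    (h : ∀ x v : Vec n, HasDerivAt (fun t : ℝ => u (proj (x + t • v))) (∑ i, v i * g i (proj x)) 0) :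
    HasGrad u g where
  continuous := hu
  continuous_grad := hc
  hasDerivAt_zero x v := by
    obtain ⟨x, rfl⟩ := isOpenQuotientMap_proj.surjective x
    simpa only [proj_add] using h x v

theorem const (c : ℝ) : HasGrad (fun _ : Torus n => c) (fun _ _ => 0) where
  continuous := continuous_const
  continuous_grad _ := continuous_const
  hasDerivAt_zero x v := by simpa using hasDerivAt_const (0 : ℝ) c

theorem add (hu : HasGrad u g) (hw : HasGrad w k) :
    HasGrad (fun x => u x + w x) (fun i x => g i x + k i x) where
  continuous := hu.continuous.add hw.continuous
  continuous_grad i := (hu.continuous_grad i).add (hw.continuous_grad i)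
  hasDerivAt_zero x v := by
    refine ((hu.hasDerivAt_zero x v).add (hw.hasDerivAt_zero x v)).congr_deriv ?_
    simp [mul_add, Finset.sum_add_distrib]

theorem mul (hu : HasGrad u g) (hw : HasGrad w k) :
    HasGrad (fun x => u x * w x) (fun i x => g i x * w x + u x * k i x) where
  continuous := hu.continuous.mul hw.continuous
  continuous_grad i := ((hu.continuous_grad i).mul hw.continuous).add
    (hu.continuous.mul (hw.continuous_grad i))
  hasDerivAt_zero x v := by
    refine ((hu.hasDerivAt_zero x v).mul (hw.hasDerivAt_zero x v)).congr_deriv ?_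
    simp only [zero_smul, proj_zero, add_zero, Finset.sum_mul, Finset.mul_sum,
      ← Finset.sum_add_distrib]
    exact Finset.sum_congr rfl fun i _ => by ring

theorem neg (hu : HasGrad u g) : HasGrad (fun x => -u x) (fun i x => -g i x) := by
  simpa using (const (-1)).mul hu

theorem sub (hu : HasGrad u g) (hw : HasGrad w k) :
    HasGrad (fun x => u x - w x) (fun i x => g i x - k i x) := by
  simpa [sub_eq_add_neg] using hu.add hw.neg

theorem comp {F F' : ℝ → ℝ} (hF : ∀ s, HasDerivAt F (F' s) s) (hF' : Continuous F')
    (hu : HasGrad u g) : HasGrad (fun x => F (u x)) (fun i x => F' (u x) * g i x) where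
  continuous := (continuous_iff_continuousAt.2 fun s => (hF s).continuousAt).comp hu.continuous
  continuous_grad i := (hF'.comp hu.continuous).mul (hu.continuous_grad i)
  hasDerivAt_zero x v := by
    refine ((hF _).comp 0 (hu.hasDerivAt_zero x v)).congr_deriv ?_
    simp only [zero_smul, proj_zero, add_zero, Finset.mul_sum]
    exact Finset.sum_congr rfl fun i _ => by ring

theorem translate (hu : HasGrad u g) (a : Torus n) :
    HasGrad (fun x => u (x + a)) (fun i x => g i (x + a)) where
  continuous := hu.continuous.comp (continuous_add_const a)
  continuous_grad i := (hu.continuous_grad i).comp (continuous_add_const a)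
  hasDerivAt_zero x v := by
    simpa only [add_right_comm] using hu.hasDerivAt_zero (x + a) v

/-- The weight is merely integrable, so that it can be a function that has only weak derivatives;
`v` may vary with the point, so that it can be a displacement field. -/
theorem hasDerivAt_integral_mul (hu : HasGrad u g) {μ : Measure (Torus n)} {a : Torus n → ℝ}
    (ha : Integrable a μ) {b : Torus n → Torus n} (hb : Continuous b) {v : Torus n → Vec n}
    (hv : Continuous v) (t : ℝ) :
    HasDerivAt (fun t : ℝ => ∫ x, a x * u (b x + proj (t • v x)) ∂μ)
      (∫ x, a x * ∑ i, v x i * g i (b x + proj (t • v x)) ∂μ) t := by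
  have hp := continuous_proj (n := n)
  have hg := hu.continuous_grad
  have hc := hu.continuous
  refine hasDerivAt_integral_mul_of_continuousOn ha (O := Set.univ)
    (K := fun t x => u (b x + proj (t • v x)))
    (K' := fun t x => ∑ i, v x i * g i (b x + proj (t • v x))) isOpen_univ ?_ ?_ ?_ trivial
  · intro t _; fun_prop
  · apply Continuous.continuousOn; fun_prop
  · exact fun t _ x => hu.hasDerivAt (b x) (v x) t

theorem hasDerivAt_integral (hu : HasGrad u g) {μ : Measure (Torus n)} [IsFiniteMeasure μ]
    {b : Torus n → Torus n} (hb : Continuous b) {v : Torus n → Vec n}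
    (hv : Continuous v) (t : ℝ) :
    HasDerivAt (fun t : ℝ => ∫ x, u (b x + proj (t • v x)) ∂μ)
      (∫ x, ∑ i, v x i * g i (b x + proj (t • v x)) ∂μ) t := by
  simpa using hu.hasDerivAt_integral_mul (μ := μ) (a := fun _ => 1) (integrable_const _) hb hv t

/-- By translation invariance `∫ u(x + t eᵢ) dx` does not depend on `t`. -/
theorem integral_grad_eq_zero (hu : HasGrad u g) (i : Fin n) : ∫ x, g i x = 0 := by
  have h := hu.hasDerivAt_integral (μ := volume) continuous_id
    (continuous_const (y := EuclideanSpace.single i (1 : ℝ))) 0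
  simp only [id, integral_add_right_eq_self (fun x => u x)] at h
  have := h.unique (hasDerivAt_const _ _)
  simpa [PiLp.single_apply] using this

/-- Integration by parts on the torus. -/
theorem integral_mul_grad (hu : HasGrad u g) (hw : HasGrad w k) (i : Fin n) :
    ∫ x, u x * k i x = -∫ x, g i x * w x := by
  have h := (hu.mul hw).integral_grad_eq_zero i
  have h' := integral_add (integrable_of_continuous (μ := volume)
    ((hu.continuous_grad i).mul hw.continuous))
    (integrable_of_continuous (hu.continuous.mul (hw.continuous_grad i)))
  simp only [Pi.mul_apply] at h'
  linarith

/-- `∫ ∂ⱼu ∂ᵢw = ∫ ∂ᵢu ∂ⱼw` for `C¹` functions on the torus. -/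
theorem integral_grad_mul_grad_comm (hu : HasGrad u g) (hw : HasGrad w k) (i j : Fin n) :
    ∫ x, g j x * k i x = ∫ x, g i x * k j x := by
  set e := EuclideanSpace.single i (1 : ℝ)
  have h1 := hw.hasDerivAt_integral_mul (integrable_of_continuous (μ := volume)
    (hu.continuous_grad j)) continuous_id (continuous_const (y := e)) 0
  have h2 := (hu.hasDerivAt_integral_mul (integrable_of_continuous (μ := volume)
    (hw.continuous_grad j)) continuous_id (continuous_const (y := -e)) 0).neg
  -- Integrating by parts in direction `j` and translating shifts the increment from `w` to `u`.
  -- Both sides are differentiable in `t` although `u` and `w` are only `C¹`; their derivatives at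
  -- `0` are the two sides of the claim.
  have h3 : (fun t : ℝ => ∫ x, g j x * w (id x + proj (t • e))) =
      -fun t : ℝ => ∫ x, k j x * u (id x + proj (t • -e)) := by
    ext t
    have h := (hu.translate (proj (t • -e))).integral_mul_grad hw j
    have h' := integral_add_right_eq_self (μ := volume)
      (fun x => g j (x + proj (t • -e)) * w x) (proj (t • e))
    simp only [add_assoc, ← proj_add, ← smul_add, add_neg_cancel, smul_zero, proj_zero,
      add_zero] at h'
    simp only [Pi.neg_apply, id]
    rw [h', ← neg_eq_iff_eq_neg, ← h]
    simp only [mul_comm]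
  rw [h3] at h1
  have h4 := h1.unique h2
  simp [e, PiLp.single_apply, integral_neg] at h4
  rw [h4]
  simp only [mul_comm]

end HasGrad

/-! ### Poincaré inequality, Bochner identity and spectral gap. -/

instance isProbabilityMeasure_restrict_Ioc :
    IsProbabilityMeasure ((volume : Measure ℝ).restrict (Set.Ioc 0 1)) :=
  ⟨by simp⟩

theorem exists_forall_abs_le {X : Type*} [TopologicalSpace X] [CompactSpace X] {h : X → ℝ}
    (hh : Continuous h) : ∃ C, 0 ≤ C ∧ ∀ x, |h x| ≤ C := by
  obtain ⟨C, hC⟩ := (isCompact_univ (X := X)).exists_bound_of_continuousOn hh.continuousOn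
  exact ⟨max C 0, le_max_right _ _, fun x => (hC x trivial).trans (le_max_left _ _)⟩

theorem integral_integral_swap_of_bounded {X Y : Type*} [TopologicalSpace X] [TopologicalSpace Y]
    [SecondCountableTopology X] [SecondCountableTopology Y]
    [MeasurableSpace X] [MeasurableSpace Y] [BorelSpace X] [BorelSpace Y]
    {μ : Measure X} {ν : Measure Y} [IsFiniteMeasure μ] [IsFiniteMeasure ν] {h : X → Y → ℝ}
    (hh : Continuous fun z : X × Y => h z.1 z.2) {C : ℝ} (hC : ∀ x y, |h x y| ≤ C) :
    ∫ x, ∫ y, h x y ∂ν ∂μ = ∫ y, ∫ x, h x y ∂μ ∂ν :=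
  integral_integral_swap
    (Integrable.of_bound hh.measurable.aestronglyMeasurable C (.of_forall fun z => hC z.1 z.2))

theorem sq_integral_le_integral_sq {X : Type*} [MeasurableSpace X] {P : Measure X}
    [IsProbabilityMeasure P] {h : X → ℝ} (h1 : Integrable h P)
    (h2 : Integrable (fun x => h x ^ 2) P) : (∫ x, h x ∂P) ^ 2 ≤ ∫ x, h x ^ 2 ∂P := by
  set m := ∫ x, h x ∂P with hm
  have h0 : 0 ≤ ∫ x, (h x ^ 2 - 2 * m * h x + m ^ 2) ∂P :=
    integral_nonneg fun x => by
      change 0 ≤ h x ^ 2 - 2 * m * h x + m ^ 2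
      nlinarith [sq_nonneg (h x - m)]
  have h3 : Integrable (fun x => h x ^ 2 - 2 * m * h x) P := h2.sub (h1.const_mul _)
  rw [integral_add h3 (integrable_const _),
    integral_sub h2 (h1.const_mul _), integral_const_mul, ← hm] at h0
  simp at h0
  nlinarith

namespace HasGrad

variable {u φ W : Torus n → ℝ} {g G W₁ : Fin n → Torus n → ℝ} {A W₂ : Fin n → Fin n → Torus n → ℝ}

theorem sub_eq_integral (h : HasGrad u g) (x : Torus n) (v : Vec n) :
    u (x + proj v) - u x = ∫ s in Set.Ioc (0 : ℝ) 1, ∑ i, v i * g i (x + proj (s • v)) := by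
  have hp := continuous_proj (n := n)
  have hg := h.continuous_grad
  rw [← intervalIntegral.integral_of_le zero_le_one,
    intervalIntegral.integral_eq_sub_of_hasDerivAt (fun s _ => h.hasDerivAt x v s)]
  · simp
  · apply Continuous.intervalIntegrable
    fun_prop

/-- Write the increment as an integral along the segment, apply Cauchy–Schwarz in the sum and in
`s`, then exchange integrals: by translation invariance every `s` contributes the same. -/
theorem integral_sq_sub_le (h : HasGrad u g) {v : Vec n} (hv : v ∈ cube n) :
    ∫ x, (u (x + proj v) - u x) ^ 2 ≤ (n + 1) * ∫ x, ∑ i, g i x ^ 2 := by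
  have hp := continuous_proj (n := n)
  have hg := h.continuous_grad
  have hu := h.continuous
  have hcs : Continuous fun x => ∑ i, g i x ^ 2 := by fun_prop
  obtain ⟨C, hC0, hC⟩ := exists_forall_abs_le hcs
  -- The bound `n` would do; `n + 1` keeps the constant positive for `n = 0`.
  have hvn : ∑ i, v i ^ 2 ≤ n + 1 := by
    calc ∑ i, v i ^ 2 ≤ ∑ _i : Fin n, (1 : ℝ) :=
          Finset.sum_le_sum fun i _ => by have := hv i; nlinarith [this.1, this.2]
      _ ≤ n + 1 := by simp
  have hs0 : ∀ x, 0 ≤ ∑ i, g i x ^ 2 := fun x => Finset.sum_nonneg fun i _ => sq_nonneg _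
  have hpt : ∀ x, (∑ i, v i * g i x) ^ 2 ≤ (n + 1) * ∑ i, g i x ^ 2 := fun x =>
    (Finset.sum_mul_sq_le_sq_mul_sq _ _ _).trans (mul_le_mul_of_nonneg_right hvn (hs0 x))
  have hint : ∀ {k : ℝ → ℝ} {D : ℝ}, Continuous k → (∀ s, |k s| ≤ D) →
      Integrable k (volume.restrict (Set.Ioc (0 : ℝ) 1)) := fun hk hD =>
    Integrable.of_bound hk.aestronglyMeasurable _ (.of_forall hD)
  have hcl : Continuous fun x => ∑ i, v i * g i x := by fun_prop
  obtain ⟨D, hD0, hD⟩ := exists_forall_abs_le hcl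
  have key : ∀ x, (u (x + proj v) - u x) ^ 2 ≤
      ∫ s in Set.Ioc (0 : ℝ) 1, (n + 1) * ∑ i, g i (x + proj (s • v)) ^ 2 := fun x => by
    rw [h.sub_eq_integral]
    have hi := hint (k := fun s => (∑ i, v i * g i (x + proj (s • v))) ^ 2) (D := (n + 1) * C)
      (by fun_prop) fun s => by
        rw [abs_of_nonneg (sq_nonneg _)]
        exact (hpt _).trans (mul_le_mul_of_nonneg_left ((le_abs_self _).trans (hC _)) (by positivity))
    refine (sq_integral_le_integral_sq (hint (D := D) (by fun_prop) fun s => hD _) hi).trans ?_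
    refine integral_mono hi (hint (D := (n + 1) * C) (by fun_prop) fun s => ?_) fun s => hpt _
    rw [abs_mul, abs_of_nonneg (by positivity : (0 : ℝ) ≤ n + 1)]
    exact mul_le_mul_of_nonneg_left (hC _) (by positivity)
  calc ∫ x, (u (x + proj v) - u x) ^ 2
      ≤ ∫ x, ∫ s in Set.Ioc (0 : ℝ) 1, (n + 1) * ∑ i, g i (x + proj (s • v)) ^ 2 := by
        refine integral_mono (integrable_of_continuous (by fun_prop)) ?_ key
        refine Integrable.integral_prod_left (f := fun z : Torus n × ℝ =>
          (n + 1) * ∑ i, g i (z.1 + proj (z.2 • v)) ^ 2) ?_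
        refine Integrable.of_bound (C := (n + 1) * C)
          (Continuous.aestronglyMeasurable (by fun_prop)) (.of_forall fun z => ?_)
        rw [Real.norm_eq_abs, abs_mul, abs_of_nonneg (by positivity : (0 : ℝ) ≤ n + 1)]
        exact mul_le_mul_of_nonneg_left (hC _) (by positivity)
    _ = ∫ s in Set.Ioc (0 : ℝ) 1, ∫ x, (n + 1) * ∑ i, g i (x + proj (s • v)) ^ 2 := by
        refine integral_integral_swap_of_bounded (by fun_prop) (C := (n + 1) * C) fun x s => ?_
        rw [abs_mul, abs_of_nonneg (by positivity : (0 : ℝ) ≤ n + 1)]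
        exact mul_le_mul_of_nonneg_left (hC _) (by positivity)
    _ = (n + 1) * ∫ x, ∑ i, g i x ^ 2 := by
        simp only [integral_const_mul, integral_add_right_eq_self (fun x => ∑ i, g i x ^ 2)]
        simp

/-- The Poincaré inequality on the torus. -/
theorem poincare (h : HasGrad u g) :
    ∫ x, (u x - ∫ y, u y) ^ 2 ≤ (n + 1) * ∫ x, ∑ i, g i x ^ 2 := by
  have hu := h.continuous
  -- The mean is the average of `u (x + z)` over all `z`, and each `z` lifts to the cube, so the
  -- increment estimate applies to each `z`.
  have hc : ∀ x, u x - ∫ y, u y = ∫ z, (u x - u (x + z)) := fun x => by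
    rw [integral_sub (integrable_const _) (integrable_of_continuous (by fun_prop)),
      integral_add_left_eq_self (fun x => u x)]
    simp
  have hi : Continuous fun z : Torus n × Torus n => (u (z.1 + z.2) - u z.1) ^ 2 := by fun_prop
  obtain ⟨C, -, hC⟩ := exists_forall_abs_le hi
  have hint : Integrable (fun z : Torus n × Torus n => (u (z.1 + z.2) - u z.1) ^ 2)
      (volume.prod volume) := integrable_of_continuous hi
  calc ∫ x, (u x - ∫ y, u y) ^ 2 ≤ ∫ x, ∫ z, (u (x + z) - u x) ^ 2 := by
        refine integral_mono (integrable_of_continuous (by fun_prop)) hint.integral_prod_left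
          fun x => ?_
        change (u x - ∫ y, u y) ^ 2 ≤ _
        rw [hc x]
        refine (sq_integral_le_integral_sq (integrable_of_continuous (by fun_prop))
          (integrable_of_continuous (by fun_prop))).trans_eq ?_
        exact integral_congr_ae (.of_forall fun z => by ring)
    _ = ∫ z, ∫ x, (u (x + z) - u x) ^ 2 :=
        integral_integral_swap_of_bounded hi fun x z => hC (x, z)
    _ ≤ ∫ _z : Torus n, (n + 1) * ∫ x, ∑ i, g i x ^ 2 := by
        refine integral_mono hint.integral_prod_right (integrable_const _) fun z => ?_
        obtain ⟨v, hv, rfl⟩ := exists_mem_cube_proj_eq z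
        exact h.integral_sq_sub_le hv
    _ = _ := by simp

/-- The Poincaré inequality for the weight `exp (-W)`. -/
theorem poincare_exp_neg (h : HasGrad u g) (hW : Continuous W) {M : ℝ} (hM : ∀ x, |W x| ≤ M) :
    ∫ x, (u x - ∫ y, u y) ^ 2 * Real.exp (-W x) ≤
      (n + 1) * Real.exp (2 * M) * ∫ x, (∑ i, g i x ^ 2) * Real.exp (-W x) := by
  have hu := h.continuous
  have hg := h.continuous_grad
  -- Holley–Stroock perturbation: one factor `exp M` to pass to Lebesgue measure, another to return.
  -- The mean stays the unweighted one, which is harmless because any constant serves later.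
  calc ∫ x, (u x - ∫ y, u y) ^ 2 * Real.exp (-W x)
      ≤ ∫ x, (u x - ∫ y, u y) ^ 2 * Real.exp M := by
        refine integral_mono (integrable_of_continuous (by fun_prop))
          (integrable_of_continuous (by fun_prop)) fun x => ?_
        refine mul_le_mul_of_nonneg_left (Real.exp_le_exp.2 ?_) (sq_nonneg _)
        exact (neg_le_abs _).trans (hM x)
    _ ≤ ((n + 1) * ∫ x, ∑ i, g i x ^ 2) * Real.exp M := by
        rw [integral_mul_const]
        exact mul_le_mul_of_nonneg_right h.poincare (Real.exp_pos _).le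
    _ = (n + 1) * Real.exp M * ∫ x, ∑ i, g i x ^ 2 := by ring
    _ ≤ (n + 1) * Real.exp M * ∫ x, Real.exp M * ((∑ i, g i x ^ 2) * Real.exp (-W x)) := by
        refine mul_le_mul_of_nonneg_left ?_ (by positivity)
        refine integral_mono (integrable_of_continuous (by fun_prop))
          (integrable_of_continuous (by fun_prop)) fun x => ?_
        change ∑ i, g i x ^ 2 ≤ Real.exp M * ((∑ i, g i x ^ 2) * Real.exp (-W x))
        rw [mul_left_comm, ← Real.exp_add]
        refine le_mul_of_one_le_right (Finset.sum_nonneg fun i _ => sq_nonneg _)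
          (Real.one_le_exp ?_)
        linarith [(le_abs_self _).trans (hM x)]
    _ = _ := by rw [integral_const_mul, two_mul, Real.exp_add]; ring

theorem exp_neg (hW : HasGrad W W₁) :
    HasGrad (fun x => Real.exp (-W x)) (fun i x => -Real.exp (-W x) * W₁ i x) :=
  hW.comp (F := fun s => Real.exp (-s)) (F' := fun s => -Real.exp (-s))
    (fun s => by simpa using (hasDerivAt_neg s).exp) (by fun_prop)

/-- The Bochner identity for the weight `exp (-W)`. -/
theorem bochner (hG : ∀ i, HasGrad (G i) (A i)) (hW : HasGrad W W₁)
    (hW₁ : ∀ i, HasGrad (W₁ i) (W₂ i)) :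
    ∫ x, (∑ i, A i i x - ∑ i, W₁ i x * G i x) ^ 2 * Real.exp (-W x) =
      ∫ x, (∑ i, ∑ j, A i j x * A j i x + ∑ i, ∑ j, W₂ i j x * G i x * G j x) *
        Real.exp (-W x) := by
  have hw : ∀ i, HasGrad (fun x => Real.exp (-W x) * G i x)
      (fun k x => -Real.exp (-W x) * W₁ k x * G i x + Real.exp (-W x) * A i k x) :=
    fun i => hW.exp_neg.mul (hG i)
  have hq : ∀ j, HasGrad (fun x => W₁ j x * G j x)
      (fun k x => W₂ j k x * G j x + W₁ j x * A j k x) := fun j => (hW₁ j).mul (hG j)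
  have cW := hW.continuous
  have cW₁ := fun i => (hW₁ i).continuous
  have cW₂ := fun i => (hW₁ i).continuous_grad
  have cG := fun i => (hG i).continuous
  have cA := fun i => (hG i).continuous_grad
  -- Expand one factor of the square against the divergence of `exp (-W) G`. `I1` exchanges the
  -- indices of the derivatives and `I2` integrates by parts; the mixed terms `W₁ j * A j i * G i`
  -- produced by the two cancel in `e2`.
  have I1 : ∀ i j, ∫ x, A j j x *
        (-Real.exp (-W x) * W₁ i x * G i x + Real.exp (-W x) * A i i x) =
      ∫ x, A j i x * (-Real.exp (-W x) * W₁ j x * G i x + Real.exp (-W x) * A i j x) :=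
    fun i j => (hG j).integral_grad_mul_grad_comm (hw i) i j
  have I2 : ∀ i j, ∫ x, W₁ j x * G j x *
        (-Real.exp (-W x) * W₁ i x * G i x + Real.exp (-W x) * A i i x) =
      -∫ x, (W₂ j i x * G j x + W₁ j x * A j i x) * (Real.exp (-W x) * G i x) :=
    fun i j => (hq j).integral_mul_grad (hw i) i
  have e1 : ∀ x, (∑ i, A i i x - ∑ i, W₁ i x * G i x) ^ 2 * Real.exp (-W x) =
      ∑ j, ∑ i, (A j j x * (-Real.exp (-W x) * W₁ i x * G i x + Real.exp (-W x) * A i i x) -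
        W₁ j x * G j x *
          (-Real.exp (-W x) * W₁ i x * G i x + Real.exp (-W x) * A i i x)) := fun x => by
    rw [sq, ← Finset.sum_sub_distrib, Finset.sum_mul_sum, Finset.sum_mul]
    refine Finset.sum_congr rfl fun j _ => ?_
    rw [Finset.sum_mul]
    exact Finset.sum_congr rfl fun i _ => by ring
  have e2 : ∀ x, (∑ i, ∑ j, A i j x * A j i x + ∑ i, ∑ j, W₂ i j x * G i x * G j x) *
        Real.exp (-W x) =
      ∑ j, ∑ i, (A j i x * (-Real.exp (-W x) * W₁ j x * G i x + Real.exp (-W x) * A i j x) +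
        (W₂ j i x * G j x + W₁ j x * A j i x) * (Real.exp (-W x) * G i x)) := fun x => by
    rw [← Finset.sum_add_distrib, Finset.sum_mul]
    refine Finset.sum_congr rfl fun j _ => ?_
    rw [← Finset.sum_add_distrib, Finset.sum_mul]
    exact Finset.sum_congr rfl fun i _ => by ring
  simp only [e1, e2]
  rw [integral_finsetSum _ fun j _ => integrable_of_continuous (by fun_prop),
    integral_finsetSum _ fun j _ => integrable_of_continuous (by fun_prop)]
  refine Finset.sum_congr rfl fun j _ => ?_
  rw [integral_finsetSum _ fun j _ => integrable_of_continuous (by fun_prop),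
    integral_finsetSum _ fun j _ => integrable_of_continuous (by fun_prop)]
  refine Finset.sum_congr rfl fun i _ => ?_
  rw [integral_sub (integrable_of_continuous (by fun_prop)) (integrable_of_continuous (by fun_prop)),
    integral_add (integrable_of_continuous (by fun_prop)) (integrable_of_continuous (by fun_prop)),
    I1, I2, sub_neg_eq_add]

/-- The spectral gap of the weight `exp (-W)`, in its second-variation form. -/
theorem spectral_gap (hφ : HasGrad φ G) (hG : ∀ i, HasGrad (G i) (A i)) (hW : HasGrad W W₁)
    (hW₁ : ∀ i, HasGrad (W₁ i) (W₂ i)) {M : ℝ} (hM : ∀ x, |W x| ≤ M) :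
    Real.exp (-(2 * M)) / (n + 1) * ∫ x, (∑ i, G i x ^ 2) * Real.exp (-W x) ≤
      ∫ x, (∑ i, ∑ j, A i j x * A j i x + ∑ i, ∑ j, W₂ i j x * G i x * G j x) *
        Real.exp (-W x) := by
  rw [← bochner hG hW hW₁]
  set c := ∫ y, φ y
  set E := ∫ x, (∑ i, G i x ^ 2) * Real.exp (-W x) with hE
  set lam := Real.exp (-(2 * M)) / (n + 1) with hlam
  have hlam0 : 0 < lam := by positivity
  have cφ := hφ.continuous
  have cW := hW.continuous
  have cW₁ := fun i => (hW₁ i).continuous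
  have cG := fun i => (hG i).continuous
  have cA := fun i => (hG i).continuous_grad
  -- Poincaré, with `lam` the inverse of its constant.
  have hP : lam * ∫ x, (φ x - c) ^ 2 * Real.exp (-W x) ≤ E := by
    have h := mul_le_mul_of_nonneg_left (hφ.poincare_exp_neg cW hM) hlam0.le
    refine h.trans_eq ?_
    rw [← mul_assoc, hlam, Real.exp_neg]
    field_simp
    rfl
  -- Integration by parts: `E = -∫ (φ - c) Lφ exp (-W)`.
  have hI : E = -∫ x, (φ x - c) * (∑ i, A i i x - ∑ i, W₁ i x * G i x) * Real.exp (-W x) := by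
    have hb : ∀ i, ∫ x, (φ x - c) *
        (-Real.exp (-W x) * W₁ i x * G i x + Real.exp (-W x) * A i i x) =
        -∫ x, (G i x - 0) * (Real.exp (-W x) * G i x) := fun i =>
      (hφ.sub (.const c)).integral_mul_grad (hW.exp_neg.mul (hG i)) i
    have e1 : ∀ x, (φ x - c) * (∑ i, A i i x - ∑ i, W₁ i x * G i x) * Real.exp (-W x) =
        ∑ i, (φ x - c) * (-Real.exp (-W x) * W₁ i x * G i x + Real.exp (-W x) * A i i x) :=
      fun x => by
        rw [← Finset.sum_sub_distrib, Finset.mul_sum, Finset.sum_mul]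
        exact Finset.sum_congr rfl fun i _ => by ring
    simp only [e1]
    rw [integral_finsetSum _ fun j _ => integrable_of_continuous (by fun_prop)]
    simp only [hb, Finset.sum_neg_distrib, neg_neg]
    rw [← integral_finsetSum _ fun j _ => integrable_of_continuous (by fun_prop), hE]
    refine integral_congr_ae (.of_forall fun x => ?_)
    simp only [Finset.sum_mul]
    exact Finset.sum_congr rfl fun i _ => by ring
  -- The integral of `(lam (φ - c) + Lφ)² exp (-W)`, expanded. With `hI` and `hP` it gives `∫ (Lφ)²
  -- exp (-W) ≥ 2 lam E - lam E`.
  have hY : 0 ≤ ∫ x, ((lam * (φ x - c) ^ 2 * Real.exp (-W x)) * lam +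
      2 * lam * ((φ x - c) * (∑ i, A i i x - ∑ i, W₁ i x * G i x) * Real.exp (-W x)) +
      (∑ i, A i i x - ∑ i, W₁ i x * G i x) ^ 2 * Real.exp (-W x)) :=
    integral_nonneg fun x => by
      have := mul_nonneg (sq_nonneg (lam * (φ x - c) + (∑ i, A i i x - ∑ i, W₁ i x * G i x)))
        (Real.exp_pos (-W x)).le
      change 0 ≤ _ + _
      linarith
  rw [integral_add (integrable_of_continuous (by fun_prop)) (integrable_of_continuous (by fun_prop)),
    integral_add (integrable_of_continuous (by fun_prop)) (integrable_of_continuous (by fun_prop)),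
    integral_mul_const, integral_const_mul] at hY
  simp only [mul_assoc lam, integral_const_mul] at hY
  have := mul_le_mul_of_nonneg_left hP hlam0.le
  nlinarith

end HasGrad

/-! ### Functions with a differentiable lift -/

theorem hasDerivAt_lift {u : Torus n → ℝ} {x : Vec n}
    (h : DifferentiableAt ℝ (fun x : Vec n => u (proj x)) x) (v : Vec n) :
    HasDerivAt (fun t : ℝ => u (proj (x + t • v))) (fderiv ℝ (fun x : Vec n => u (proj x)) x v) 0 := by
  have h1 : HasDerivAt (fun t : ℝ => x + t • v) v 0 := by
    simpa using ((hasDerivAt_id (0 : ℝ)).smul_const v).const_add x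
  have h2 : HasFDerivAt (fun x : Vec n => u (proj x)) (fderiv ℝ (fun x : Vec n => u (proj x)) x)
      (x + (0 : ℝ) • v) := by simpa using h.hasFDerivAt
  exact h2.comp_hasDerivAt (0 : ℝ) h1

theorem partialDeriv_proj {u : Torus n → ℝ} {x : Vec n}
    (h : DifferentiableAt ℝ (fun x : Vec n => u (proj x)) x) (i : Fin n) :
    partialDeriv i u (proj x) =
      fderiv ℝ (fun x : Vec n => u (proj x)) x (EuclideanSpace.single i 1) := by
  simp only [partialDeriv, ← proj_add]
  exact (hasDerivAt_lift h _).deriv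

theorem hasGrad_of_contDiff {u : Torus n → ℝ} (h : ContDiff ℝ 1 fun x : Vec n => u (proj x)) :
    HasGrad u (fun i => partialDeriv i u) := by
  have hd : Differentiable ℝ fun x : Vec n => u (proj x) := h.differentiable one_ne_zero
  refine .of_hasDerivAt_lift (fun i => continuous_of_comp_proj ?_)
    (continuous_of_comp_proj h.continuous) fun x v => ?_
  · simp only [partialDeriv_proj (hd _)]
    exact (h.continuous_fderiv one_ne_zero).clm_apply continuous_const
  · refine (hasDerivAt_lift (hd x) v).congr_deriv ?_
    simp only [partialDeriv_proj (hd _)]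
    conv_lhs => rw [← (EuclideanSpace.basisFun (Fin n) ℝ).sum_repr v]
    simp

theorem contDiff_partialDeriv {u : Torus n → ℝ} {k m : WithTop ℕ∞}
    (h : ContDiff ℝ k fun x : Vec n => u (proj x)) (hmk : m + 1 ≤ k) (i : Fin n) :
    ContDiff ℝ m fun x : Vec n => partialDeriv i u (proj x) := by
  have hd : Differentiable ℝ fun x : Vec n => u (proj x) :=
    (h.of_le ((le_add_self).trans hmk)).differentiable one_ne_zero
  simp only [partialDeriv_proj (hd _)]
  exact (h.fderiv_right hmk).clm_apply contDiff_const

namespace Smooth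

variable {ζ : Torus n → ℝ}

theorem hasGrad (h : Smooth ζ) : HasGrad ζ (fun i => partialDeriv i ζ) :=
  hasGrad_of_contDiff (ContDiff.of_le h (by exact_mod_cast le_top))

theorem partialDeriv (h : Smooth ζ) (i : Fin n) : Smooth (partialDeriv i ζ) :=
  contDiff_partialDeriv h (by rfl) i

theorem translate (h : Smooth ζ) (a : Torus n) : Smooth (fun x => ζ (x + a)) := by
  obtain ⟨a, rfl⟩ := isOpenQuotientMap_proj.surjective a
  have h' : ContDiff ℝ ∞ fun x : Vec n => ζ (proj x) := h
  have := h'.comp (contDiff_id.add contDiff_const : ContDiff ℝ ∞ fun x : Vec n => x + a)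
  simp only [Smooth, ← proj_add]
  exact this

end Smooth

theorem partialDeriv_translate (ζ : Torus n → ℝ) (a x : Torus n) (i : Fin n) :
    partialDeriv i (fun x => ζ (x + a)) x = partialDeriv i ζ (x + a) := by
  simp only [partialDeriv, add_right_comm]

/-! ### Smooth functions are dense -/

/-- The algebra of smooth functions on the torus. -/
def smoothSubalgebra (n : ℕ) : Subalgebra ℝ C(Torus n, ℝ) where
  carrier := {ζ | Smooth ζ}
  mul_mem' (ha : ContDiff ℝ ∞ _) (hb : ContDiff ℝ ∞ _) := ha.mul hb
  add_mem' (ha : ContDiff ℝ ∞ _) (hb : ContDiff ℝ ∞ _) := ha.add hb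
  algebraMap_mem' r := (contDiff_const : ContDiff ℝ ∞ fun _ : Vec n => r)

/-- The real and imaginary parts of the characters `exp (2πi xᵢ)` are smooth and separate points. -/
theorem smoothSubalgebra_separatesPoints : (smoothSubalgebra n).SeparatesPoints := by
  intro x y hxy
  obtain ⟨i, hi⟩ := Function.ne_iff.1 hxy
  have hne : (AddCircle.toCircle (x i) : ℂ) ≠ AddCircle.toCircle (y i) := fun h =>
    hi (AddCircle.injective_toCircle one_ne_zero (Subtype.ext h))
  have hlift : ContDiff ℝ ∞ fun x : Vec n => (AddCircle.toCircle (proj x i) : ℂ) := by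
    simp only [proj, AddCircle.toCircle_apply_mk, Circle.coe_exp]
    have : ContDiff ℝ ∞ fun x : Vec n => ((2 * Real.pi / 1 * x i : ℝ) : ℂ) :=
      Complex.ofRealCLM.contDiff.comp (contDiff_const.mul
        (EuclideanSpace.proj (𝕜 := ℝ) i : Vec n →L[ℝ] ℝ).contDiff)
    exact (this.mul contDiff_const).cexp
  have hcont : Continuous fun x : Torus n => (AddCircle.toCircle (x i) : ℂ) :=
    continuous_subtype_val.comp (AddCircle.continuous_toCircle.comp (continuous_apply i))
  by_cases hre : (AddCircle.toCircle (x i) : ℂ).re = (AddCircle.toCircle (y i) : ℂ).re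
  · refine ⟨_, ⟨⟨fun x => (AddCircle.toCircle (x i) : ℂ).im, Complex.continuous_im.comp hcont⟩,
      Complex.imCLM.contDiff.comp hlift, rfl⟩, fun him => hne (Complex.ext hre him)⟩
  · exact ⟨_, ⟨⟨fun x => (AddCircle.toCircle (x i) : ℂ).re, Complex.continuous_re.comp hcont⟩,
      Complex.reCLM.contDiff.comp hlift, rfl⟩, hre⟩

/-- Stone–Weierstrass: pairing with `w ∈ L¹` is continuous in the sup norm and vanishes on a dense
subalgebra. -/
theorem integral_mul_continuous_eq_zero {w : Torus n → ℝ} (hw : Integrable w)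
    (h : ∀ ζ, Smooth ζ → ∫ x, w x * ζ x = 0) (b : C(Torus n, ℝ)) : ∫ x, w x * b x = 0 := by
  have hb : b ∈ (smoothSubalgebra n).topologicalClosure := by
    rw [ContinuousMap.subalgebra_topologicalClosure_eq_top_of_separatesPoints _
      smoothSubalgebra_separatesPoints]
    trivial
  rw [← SetLike.mem_coe, Subalgebra.topologicalClosure_coe] at hb
  have hint : ∀ b : C(Torus n, ℝ), Integrable fun x => w x * b x := fun b =>
    hw.mul_bdd (c := ‖b‖) b.continuous.aestronglyMeasurable (.of_forall b.norm_coe_le_norm)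
  have hcl : IsClosed {b : C(Torus n, ℝ) | ∫ x, w x * b x = 0} := by
    refine isClosed_eq (LipschitzWith.continuous (K := (∫ x, ‖w x‖).toNNReal) ?_) continuous_const
    refine LipschitzWith.of_dist_le_mul fun b c => ?_
    rw [Real.coe_toNNReal _ (integral_nonneg fun _ => norm_nonneg _), Real.dist_eq, dist_eq_norm,
      ← integral_sub (hint b) (hint c), ← integral_mul_const]
    refine norm_integral_le_of_norm_le (f := fun x => w x * b x - w x * c x)
      (hw.norm.mul_const _) (.of_forall fun x => ?_)
    rw [← mul_sub, norm_mul]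
    exact mul_le_mul_of_nonneg_left ((b - c).norm_coe_le_norm x) (norm_nonneg _)
  exact closure_minimal (t := {b : C(Torus n, ℝ) | ∫ x, w x * b x = 0})
    (fun ζ hζ => h ζ hζ) hcl hb

/-- The fundamental lemma of the calculus of variations on the torus. -/
theorem ae_eq_zero_of_integral_smooth {w : Torus n → ℝ} (hw : Integrable w)
    (h : ∀ ζ, Smooth ζ → ∫ x, w x * ζ x = 0) : w =ᵐ[volume] 0 := by
  have hm : AEMeasurable w := hw.aestronglyMeasurable.aemeasurable
  have hfin : ∀ {v : Torus n → ℝ}, Integrable v →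
      ∫⁻ x, ENNReal.ofReal (v x) ≠ ⊤ := fun hv => by
    exact (lt_of_le_of_lt (lintegral_mono fun x => Real.ofReal_le_enorm _) hv.2).ne
  have f1 : IsFiniteMeasure (volume.withDensity fun x => ENNReal.ofReal (w x)) :=
    isFiniteMeasure_withDensity (hfin hw)
  have f2 : IsFiniteMeasure (volume.withDensity fun x => ENNReal.ofReal (-w x)) :=
    isFiniteMeasure_withDensity (hfin hw.neg)
  -- The positive and negative parts of `w` are densities of finite measures with the same integrals
  -- of continuous functions, so they agree almost everywhere.
  have heq : (volume.withDensity fun x => ENNReal.ofReal (w x)) =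
      volume.withDensity fun x => ENNReal.ofReal (-w x) := by
    refine ext_of_forall_integral_eq_of_IsFiniteMeasure fun b => ?_
    rw [integral_withDensity_eq_integral_toReal_smul₀ (by fun_prop) (by simp),
      integral_withDensity_eq_integral_toReal_smul₀ (by fun_prop) (by simp), ← sub_eq_zero]
    have hi : ∀ {v : Torus n → ℝ}, Integrable v →
        Integrable fun x => (ENNReal.ofReal (v x)).toReal • b x := fun {v} hv => by
      refine Integrable.mul_bdd (c := ‖b‖) ?_ b.continuous.aestronglyMeasurable
        (.of_forall b.norm_coe_le_norm)
      simpa [ENNReal.toReal_ofReal'] using hv.pos_part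
    have hs := integral_sub (hi hw) (hi hw.neg)
    simp only [Pi.neg_apply] at hs
    rw [← hs]
    refine Eq.trans ?_ (integral_mul_continuous_eq_zero hw h b.toContinuousMap)
    refine integral_congr_ae (.of_forall fun x => ?_)
    simp only [smul_eq_mul, ENNReal.toReal_ofReal', ← sub_mul]
    congr 1
    rcases le_total (w x) 0 with h0 | h0
    · rw [max_eq_right h0, max_eq_left (neg_nonneg.2 h0)]; ring
    · rw [max_eq_left h0, max_eq_right (neg_nonpos.2 h0)]; ring
  rw [withDensity_eq_iff (by fun_prop) (by fun_prop) (hfin hw)] at heq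
  filter_upwards [heq] with x hx
  rcases lt_trichotomy (w x) 0 with h0 | h0 | h0
  · rw [ENNReal.ofReal_of_nonpos h0.le, eq_comm, ENNReal.ofReal_eq_zero] at hx
    linarith
  · exact h0
  · rw [ENNReal.ofReal_of_nonpos (neg_nonpos.2 h0.le), ENNReal.ofReal_eq_zero] at hx
    linarith

/-! ### Weak derivatives -/

theorem HasWeakDeriv.congr {l : List (Fin n)} {u u' v v' : Torus n → ℝ} (h : HasWeakDeriv l u v)
    (hu : u =ᵐ[volume] u') (hv : v =ᵐ[volume] v') : HasWeakDeriv l u' v' where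
  integrable_left := h.integrable_left.congr hu
  integrable_right := h.integrable_right.congr hv
  integral_eq ζ hζ := by
    have h1 := integral_congr_ae (hu.mul (ae_eq_refl (iterPartial l ζ)))
    have h2 := integral_congr_ae (hv.mul (ae_eq_refl ζ))
    simp only [Pi.mul_apply] at h1 h2
    rw [← h1, ← h2, h.integral_eq ζ hζ]

/-- Test the first relation with `∂ⱼζ`. The Sobolev condition only lists derivatives of `u` itself;
this shows that its first derivatives are weakly differentiable in turn. -/
theorem HasWeakDeriv.tail {i j : Fin n} {u v w : Torus n → ℝ} (h : HasWeakDeriv [i] u v)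
    (h' : HasWeakDeriv [i, j] u w) : HasWeakDeriv [j] v w where
  integrable_left := h.integrable_right
  integrable_right := h'.integrable_right
  integral_eq ζ hζ := by
    have h1 := h.integral_eq _ (hζ.partialDeriv j)
    have h2 := h'.integral_eq ζ hζ
    simp only [iterPartial, List.foldr_cons, List.foldr_nil, List.length_cons, List.length_nil]
      at h1 h2 ⊢
    rw [h2] at h1
    norm_num at h1 ⊢
    linarith

section WeakGradient

variable {u : Torus n → ℝ} {g : Fin n → Torus n → ℝ}

theorem continuous_integral_mul_translate {w ζ : Torus n → ℝ} (hw : Integrable w)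
    (hζ : Continuous ζ) : Continuous fun a : Torus n => ∫ x, w x * ζ (x + a) := by
  obtain ⟨C, -, hC⟩ := exists_forall_abs_le hζ
  refine continuous_of_dominated (bound := fun x => ‖w x‖ * C)
    (fun a => hw.aestronglyMeasurable.mul (Continuous.aestronglyMeasurable (by fun_prop)))
    (fun a => .of_forall fun x => ?_) (hw.norm.mul_const C) (.of_forall fun x => by fun_prop)
  rw [norm_mul]
  exact mul_le_mul_of_nonneg_left (hC _) (norm_nonneg _)

/-- The fundamental theorem of calculus along `v`, tested against a smooth function. -/
theorem integral_mul_translate_sub (h : ∀ i, HasWeakDeriv [i] u (g i)) (hu : Integrable u)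
    {ζ : Torus n → ℝ} (hζ : Smooth ζ) (v : Vec n) :
    (∫ x, u x * ζ (x + proj (-v))) - ∫ x, u x * ζ x =
      ∫ s in Set.Ioc (0 : ℝ) 1, ∑ i, v i * ∫ x, g i x * ζ (x + proj (-(s • v))) := by
  have hp := continuous_proj (n := n)
  -- The derivative falls on `ζ`, translated by `-s v`; the weak derivative relation transfers it to
  -- `g`, and the two signs cancel.
  have hd : ∀ s : ℝ, HasDerivAt (fun s : ℝ => ∫ x, u x * ζ (x + proj (s • -v)))
      (∑ i, v i * ∫ x, g i x * ζ (x + proj (-(s • v)))) s := fun s => by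
    refine (hζ.hasGrad.hasDerivAt_integral_mul (μ := volume) hu continuous_id
      (continuous_const (y := -v)) s).congr_deriv ?_
    have hz : ∀ i, ∫ x, u x * partialDeriv i ζ (x + proj (s • -v)) =
        -∫ x, g i x * ζ (x + proj (-(s • v))) := fun i => by
      have := (h i).integral_eq _ (hζ.translate (proj (s • -v)))
      simp only [iterPartial, List.foldr_cons, List.foldr_nil, List.length_cons,
        List.length_nil, partialDeriv_translate] at this
      rw [this]
      simp
    have hi : ∀ i, Integrable fun x => u x * partialDeriv i ζ (x + proj (s • -v)) := fun i => by
      have hc := (hζ.hasGrad).continuous_grad i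
      obtain ⟨C, -, hC⟩ := exists_forall_abs_le hc
      exact hu.mul_bdd (c := C) (Continuous.aestronglyMeasurable (by fun_prop))
        (.of_forall fun x => hC _)
    simp only [Finset.mul_sum, id]
    rw [integral_finsetSum]
    · refine Finset.sum_congr rfl fun i _ => ?_
      simp only [mul_left_comm (u _), integral_const_mul, hz]
      simp
    · intro i _
      simpa only [mul_left_comm (u _)] using (hi i).const_mul _
  rw [← intervalIntegral.integral_of_le zero_le_one,
    intervalIntegral.integral_eq_sub_of_hasDerivAt (fun s _ => hd s)]
  · simp
  · apply Continuous.intervalIntegrable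
    refine continuous_finsetSum _ fun i _ => continuous_const.mul ?_
    exact (continuous_integral_mul_translate (h i).integrable_right hζ.hasGrad.continuous).comp
      (by fun_prop : Continuous fun s : ℝ => proj (-(s • v)))

theorem integral_translate_mul (w ζ : Torus n → ℝ) (v : Vec n) :
    ∫ x, w (x + proj v) * ζ x = ∫ x, w x * ζ (x + proj (-v)) := by
  rw [← integral_add_right_eq_self (fun x => w x * ζ (x + proj (-v))) (proj v)]
  simp [proj_neg]

/-- A continuous function with continuous weak gradient is continuously differentiable. -/
theorem hasGrad_of_hasWeakDeriv (hu : Continuous u) (hg : ∀ i, Continuous (g i))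
    (h : ∀ i, HasWeakDeriv [i] u (g i)) : HasGrad u g := by
  have hp := continuous_proj (n := n)
  -- The fundamental theorem of calculus holds against every test function, hence almost everywhere,
  -- hence everywhere by continuity.
  have key : ∀ (v : Vec n) (x : Torus n), u (x + proj v) - u x =
      ∫ s in Set.Ioc (0 : ℝ) 1, ∑ i, v i * g i (x + proj (s • v)) := fun v => by
    have hcl : Continuous fun x => ∑ i, v i * g i x := by fun_prop
    obtain ⟨D, hD0, hD⟩ := exists_forall_abs_le hcl
    have hcr : Continuous fun x =>
        ∫ s in Set.Ioc (0 : ℝ) 1, ∑ i, v i * g i (x + proj (s • v)) :=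
      continuous_of_dominated (bound := fun _ => D)
        (fun x => Continuous.aestronglyMeasurable (by fun_prop))
        (fun x => .of_forall fun s => hD _) (integrable_const _) (.of_forall fun s => by fun_prop)
    have hz : (fun x => u (x + proj v) - u x -
        ∫ s in Set.Ioc (0 : ℝ) 1, ∑ i, v i * g i (x + proj (s • v))) =ᵐ[volume] 0 := by
      refine ae_eq_zero_of_integral_smooth (integrable_of_continuous (by fun_prop)) fun ζ hζ => ?_
      have cζ := hζ.hasGrad.continuous
      obtain ⟨C, hC0, hC⟩ := exists_forall_abs_le cζ
      simp only [sub_mul]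
      rw [integral_sub (integrable_of_continuous (by fun_prop))
        (integrable_of_continuous (by fun_prop)), integral_sub (integrable_of_continuous (by fun_prop))
        (integrable_of_continuous (by fun_prop)), integral_translate_mul,
        integral_mul_translate_sub h (integrable_of_continuous hu) hζ, sub_eq_zero]
      simp only [← integral_mul_const]
      rw [integral_integral_swap_of_bounded (by fun_prop) (C := D * C) fun x s => by
        rw [abs_mul]; exact mul_le_mul (hD _) (hC _) (abs_nonneg _) hD0]
      refine integral_congr_ae (.of_forall fun s => ?_)
      simp only [Finset.sum_mul]
      rw [integral_finsetSum _ fun i _ => integrable_of_continuous (by fun_prop)]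
      refine Finset.sum_congr rfl fun i _ => ?_
      simp only [mul_assoc, integral_const_mul, integral_translate_mul]
    have := (Continuous.ae_eq_iff_eq volume (by fun_prop) continuous_const).1 hz
    exact fun x => sub_eq_zero.1 (congrFun this x)
  refine ⟨hu, hg, fun x v => ?_⟩
  have hF : ∀ t : ℝ, u (x + proj (t • v)) = u x + ∫ s in (0 : ℝ)..t, ∑ i, v i * g i (x + proj (s • v)) :=
    fun t => by
      have h1 := key (t • v) x
      rw [← intervalIntegral.integral_of_le zero_le_one] at h1
      have h2 := intervalIntegral.mul_integral_comp_mul_right (a := 0) (b := 1)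
        (f := fun s => ∑ i, v i * g i (x + proj (s • v))) t
      rw [zero_mul, one_mul] at h2
      rw [← h2, ← intervalIntegral.integral_const_mul, ← sub_eq_iff_eq_add', h1]
      refine intervalIntegral.integral_congr fun s _ => ?_
      simp [Finset.mul_sum, mul_assoc, smul_smul]
  simp only [hF]
  have hc : Continuous fun s : ℝ => ∑ i, v i * g i (x + proj (s • v)) := by fun_prop
  refine ((intervalIntegral.integral_hasDerivAt_right (hc.intervalIntegrable _ _)
    (hc.stronglyMeasurableAtFilter _ _) hc.continuousAt).const_add (u x)).congr_deriv ?_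
  simp

end WeakGradient

/-! ### Morrey's embedding -/

/-- Lebesgue measure on `(0, 1] × [0, 1)ⁿ`. -/
def segmentMeasure (n : ℕ) : Measure (ℝ × Vec n) :=
  (volume.restrict (Set.Ioc 0 1)).prod (volume.restrict (cube n))

instance : IsProbabilityMeasure (segmentMeasure n) := by
  unfold segmentMeasure; infer_instance

theorem ae_mem_segmentMeasure : ∀ᵐ z ∂segmentMeasure n, z.2 ∈ cube n := by
  rw [segmentMeasure, Measure.prod_restrict]
  filter_upwards [ae_restrict_mem (measurableSet_Ioc.prod measurableSet_cube)] with z hz using hz.2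

theorem abs_apply_le_of_mem_cube {y : Vec n} (hy : y ∈ cube n) (i : Fin n) : |y i| ≤ 1 := by
  rw [abs_of_nonneg (hy i).1]
  exact (hy i).2.le

theorem integrable_segmentMeasure {h : ℝ × Vec n → ℝ} (hh : Continuous h) {C : ℝ}
    (hC : ∀ z, |h z| ≤ C) (i : Fin n) :
    Integrable (fun z => z.2 i * h z) (segmentMeasure n) := by
  refine Integrable.of_bound (C := C) (Continuous.aestronglyMeasurable (by fun_prop)) ?_
  filter_upwards [ae_mem_segmentMeasure] with z hz
  rw [norm_mul]
  exact (mul_le_mul (abs_apply_le_of_mem_cube hz i) (hC z) (abs_nonneg _) zero_le_one).trans_eq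
    (one_mul C)

/-- The average of `yᵢ g` over the segments from `x` to `x + y`, with `y` in the unit cube. -/
def segmentAverage (i : Fin n) (g : Torus n → ℝ) (x : Torus n) : ℝ :=
  ∫ z, z.2 i * g (x + proj (z.1 • z.2)) ∂segmentMeasure n

theorem continuous_segmentAverage (i : Fin n) {g : Torus n → ℝ} (hg : Continuous g) :
    Continuous (segmentAverage i g) := by
  have hp := continuous_proj (n := n)
  obtain ⟨C, hC0, hC⟩ := exists_forall_abs_le hg
  refine continuous_of_dominated (bound := fun _ => C)
    (fun x => Continuous.aestronglyMeasurable (by fun_prop)) (fun x => ?_)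
    (integrable_const _) (.of_forall fun z => by fun_prop)
  filter_upwards [ae_mem_segmentMeasure] with z hz
  rw [norm_mul]
  exact (mul_le_mul (abs_apply_le_of_mem_cube hz i) (hC _) (abs_nonneg _) zero_le_one).trans_eq
    (one_mul C)

theorem segmentAverage_sub (i : Fin n) {g k : Torus n → ℝ} (hg : Continuous g)
    (hk : Continuous k) (x : Torus n) :
    segmentAverage i (fun x => g x - k x) x = segmentAverage i g x - segmentAverage i k x := by
  have hp := continuous_proj (n := n)
  obtain ⟨C, hC0, hC⟩ := exists_forall_abs_le hg
  obtain ⟨D, hD0, hD⟩ := exists_forall_abs_le hk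
  unfold segmentAverage
  rw [← integral_sub (integrable_segmentMeasure (by fun_prop) (fun z => hC _) i)
    (integrable_segmentMeasure (by fun_prop) (fun z => hD _) i)]
  simp only [mul_sub]

/-- Scaling by `s ≤ 1` keeps the cube inside itself, where the projection preserves measure, and
multiplies volumes by `s ^ n`. -/
theorem map_cube_le (x : Torus n) {s : ℝ} (hs : s ∈ Set.Ioc (0 : ℝ) 1) :
    (volume.restrict (cube n)).map (fun y => x + proj (s • y)) ≤
      ENNReal.ofReal ((s ^ n)⁻¹) • (volume : Measure (Torus n)) := by
  have hp := continuous_proj (n := n)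
  refine Measure.le_iff.2 fun B hB => ?_
  have hm : Measurable fun y : Vec n => x + proj (s • y) :=
    Continuous.measurable (by fun_prop)
  have hm' : Measurable fun y : Torus n => x + y := measurable_const_add x
  rw [Measure.map_apply hm hB, Measure.restrict_apply (hm hB), Measure.smul_apply, smul_eq_mul]
  have hv : volume B = volume (proj ⁻¹' ((fun y => x + y) ⁻¹' B) ∩ cube n) := by
    rw [← Measure.restrict_apply (hp.measurable (hm' hB)),
      measurePreserving_proj.measure_preimage (hm' hB).nullMeasurableSet,
      measure_preimage_add]
  have hsub : (fun y : Vec n => x + proj (s • y)) ⁻¹' B ∩ cube n ⊆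
      (s • ·) ⁻¹' (proj ⁻¹' ((fun y => x + y) ⁻¹' B) ∩ cube n) := by
    rintro y ⟨hy, hyc⟩
    refine ⟨hy, fun i => ?_⟩
    have := hyc i
    simp only [PiLp.smul_apply, smul_eq_mul]
    exact ⟨mul_nonneg hs.1.le this.1, by nlinarith [hs.1, hs.2, this.1, this.2]⟩
  refine (measure_mono hsub).trans_eq ?_
  rw [Measure.addHaar_preimage_smul _ hs.1.ne', hv, finrank_euclideanSpace_fin,
    abs_of_nonneg (inv_nonneg.2 (pow_nonneg hs.1.le _))]

/-- Jensen on the cube passes from `L¹` to `L^p`; the density bound `s ^ (-n)` then contributes its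
`p`-th root. -/
theorem setIntegral_cube_abs_le {g : Torus n → ℝ} (hg : Continuous g) {p : ℝ} (hp1 : 1 ≤ p)
    (x : Torus n) {s : ℝ} (hs : s ∈ Set.Ioc (0 : ℝ) 1) :
    ∫ y in cube n, |g (x + proj (s • y))| ≤
      s ^ (-(n / p)) * (eLpNorm g (ENNReal.ofReal p) volume).toReal := by
  have hp := continuous_proj (n := n)
  have hp0 : 0 < p := by linarith
  have hm : Measurable fun y : Vec n => x + proj (s • y) :=
    Continuous.measurable (by fun_prop)
  have hmem : MemLp g (ENNReal.ofReal p) volume := by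
    obtain ⟨C, -, hC⟩ := exists_forall_abs_le hg
    exact MemLp.of_bound hg.aestronglyMeasurable C (.of_forall hC)
  have h1 : ∫ y in cube n, |g (x + proj (s • y))| =
      (eLpNorm (fun y => g (x + proj (s • y))) 1 (volume.restrict (cube n))).toReal := by
    rw [eLpNorm_one_eq_lintegral_enorm]
    exact integral_norm_eq_lintegral_enorm (f := fun y => g (x + proj (s • y)))
      (Continuous.aestronglyMeasurable (by fun_prop))
  have h2 : eLpNorm (fun y => g (x + proj (s • y))) 1 (volume.restrict (cube n)) ≤
      ENNReal.ofReal (s ^ (-(n / p))) * eLpNorm g (ENNReal.ofReal p) volume := by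
    calc eLpNorm (fun y => g (x + proj (s • y))) 1 (volume.restrict (cube n))
        ≤ eLpNorm (fun y => g (x + proj (s • y))) (ENNReal.ofReal p) (volume.restrict (cube n)) :=
          eLpNorm_le_eLpNorm_of_exponent_le (by simpa using hp1)
            (Continuous.aestronglyMeasurable (by fun_prop))
      _ = eLpNorm g (ENNReal.ofReal p)
            ((volume.restrict (cube n)).map (fun y => x + proj (s • y))) :=
          (eLpNorm_map_measure hg.aestronglyMeasurable hm.aemeasurable).symm
      _ ≤ eLpNorm g (ENNReal.ofReal p) (ENNReal.ofReal ((s ^ n)⁻¹) • volume) :=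
          eLpNorm_mono_measure _ (map_cube_le x hs)
      _ = _ := by
          rw [eLpNorm_smul_measure_of_ne_top ENNReal.ofReal_ne_top, smul_eq_mul,
            ENNReal.toReal_div, ENNReal.toReal_ofReal hp0.le, ENNReal.toReal_one,
            ENNReal.ofReal_rpow_of_nonneg (inv_nonneg.2 (pow_nonneg hs.1.le _)) (by positivity)]
          congr 2
          rw [← Real.rpow_natCast, ← Real.rpow_neg hs.1.le, ← Real.rpow_mul hs.1.le]
          congr 1
          ring
  rw [h1]
  refine (ENNReal.toReal_mono (ENNReal.mul_ne_top ENNReal.ofReal_ne_top hmem.2.ne) h2).trans_eq ?_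
  rw [ENNReal.toReal_mul, ENNReal.toReal_ofReal (Real.rpow_nonneg hs.1.le _)]

/-- This is where `p > n` is needed: it makes `s ^ (-(n / p))` integrable at `0`. -/
theorem exists_abs_segmentAverage_le {p : ℝ} (hp1 : 1 ≤ p) (hpn : n < p) :
    ∃ C : ℝ, 0 ≤ C ∧ ∀ (i : Fin n) (g : Torus n → ℝ), Continuous g → ∀ x,
      |segmentAverage i g x| ≤ C * (eLpNorm g (ENNReal.ofReal p) volume).toReal := by
  have hpr := continuous_proj (n := n)
  have hi : Integrable (fun s : ℝ => s ^ (-(n / p))) (volume.restrict (Set.Ioc 0 1)) := by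
    have := intervalIntegral.intervalIntegrable_rpow' (a := 0) (b := 1) (r := -(n / p))
      (by rw [neg_lt_neg_iff, div_lt_one (by linarith)]; exact hpn)
    rwa [intervalIntegrable_iff_integrableOn_Ioc_of_le zero_le_one] at this
  refine ⟨∫ s in Set.Ioc (0 : ℝ) 1, s ^ (-(n / p)), ?_, fun i g hg x => ?_⟩
  · exact setIntegral_nonneg measurableSet_Ioc fun s hs => Real.rpow_nonneg hs.1.le _
  · obtain ⟨D, hD0, hD⟩ := exists_forall_abs_le hg
    unfold segmentAverage segmentMeasure
    rw [integral_prod _ (integrable_segmentMeasure (by fun_prop) (fun z => hD _) i),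
      ← integral_mul_const]
    refine norm_integral_le_of_norm_le (f := fun s : ℝ => ∫ y in cube n,
      y i * g (x + proj (s • y))) (hi.mul_const _) ?_
    filter_upwards [ae_restrict_mem measurableSet_Ioc] with s hs
    refine le_trans ?_ (setIntegral_cube_abs_le hg hp1 x hs)
    refine norm_integral_le_of_norm_le (f := fun y : Vec n => y i * g (x + proj (s • y))) ?_ ?_
    · exact Integrable.of_bound (Continuous.aestronglyMeasurable (by fun_prop)) D
        (.of_forall fun y => by simpa using hD _)
    · filter_upwards [ae_restrict_mem measurableSet_cube] with y hy
      rw [norm_mul]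
      exact mul_le_of_le_one_left (abs_nonneg _) (abs_apply_le_of_mem_cube hy i)

/-- The pairing of the segment averages of `g` with `ζ`. -/
def segmentPairing (i : Fin n) (g ζ : Torus n → ℝ) : ℝ :=
  ∫ z, z.2 i * (∫ x, g x * ζ (x + proj (-(z.1 • z.2)))) ∂segmentMeasure n

theorem abs_integral_mul_le {g ζ : Torus n → ℝ} (hg : Integrable g) {C : ℝ}
    (hC : ∀ x, |ζ x| ≤ C) (a : Torus n) : |∫ x, g x * ζ (x + a)| ≤ (∫ x, |g x|) * C := by
  rw [← integral_mul_const]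
  refine norm_integral_le_of_norm_le (f := fun x => g x * ζ (x + a))
    (hg.abs.mul_const C) (.of_forall fun x => ?_)
  rw [norm_mul]
  exact mul_le_mul_of_nonneg_left (hC _) (abs_nonneg _)

theorem integrable_segmentPairing (i : Fin n) {g ζ : Torus n → ℝ} (hg : Integrable g)
    (hζ : Continuous ζ) : Integrable
      (fun z : ℝ × Vec n => z.2 i * ∫ x, g x * ζ (x + proj (-(z.1 • z.2)))) (segmentMeasure n) := by
  have hp := continuous_proj (n := n)
  obtain ⟨C, hC0, hC⟩ := exists_forall_abs_le hζ
  exact integrable_segmentMeasure (h := fun z => ∫ x, g x * ζ (x + proj (-(z.1 • z.2))))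
    ((continuous_integral_mul_translate hg hζ).comp
      (by fun_prop : Continuous fun z : ℝ × Vec n => proj (-(z.1 • z.2))))
    (fun z => abs_integral_mul_le hg hC _) i

/-- Fubini and a translation. The pairing is also meaningful and `L¹`-continuous for integrable `g`,
which lets the identity pass to `L^p` limits of continuous functions. -/
theorem segmentPairing_eq (i : Fin n) {g ζ : Torus n → ℝ} (hg : Continuous g)
    (hζ : Continuous ζ) : segmentPairing i g ζ = ∫ x, segmentAverage i g x * ζ x := by
  have hp := continuous_proj (n := n)
  obtain ⟨C, hC0, hC⟩ := exists_forall_abs_le hζ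
  obtain ⟨D, hD0, hD⟩ := exists_forall_abs_le hg
  unfold segmentPairing segmentAverage
  simp only [← integral_mul_const, ← integral_translate_mul, ← integral_const_mul]
  rw [integral_integral_swap]
  · simp only [mul_assoc]
  · refine Integrable.of_bound (C := D * C) (Continuous.aestronglyMeasurable (by fun_prop)) ?_
    have : ∀ᵐ z ∂(segmentMeasure n).prod (volume : Measure (Torus n)), z.1.2 ∈ cube n :=
      Measure.quasiMeasurePreserving_fst.ae ae_mem_segmentMeasure
    filter_upwards [this] with z hz
    rw [Function.uncurry_def, norm_mul, norm_mul]
    exact (mul_le_of_le_one_left (by positivity) (abs_apply_le_of_mem_cube hz i)).trans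
      (mul_le_mul (hD _) (hC _) (abs_nonneg _) hD0)

theorem abs_segmentPairing_sub_le (i : Fin n) {g k ζ : Torus n → ℝ} (hg : Integrable g)
    (hk : Integrable k) (hζ : Continuous ζ) {C : ℝ} (hC : ∀ x, |ζ x| ≤ C) :
    |segmentPairing i g ζ - segmentPairing i k ζ| ≤ (∫ x, |g x - k x|) * C := by
  have hint : ∀ {g : Torus n → ℝ}, Integrable g → ∀ a, Integrable fun x => g x * ζ (x + a) :=
    fun hg a => hg.mul_bdd (c := C) (Continuous.aestronglyMeasurable (by fun_prop))
      (.of_forall fun x => hC _)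
  unfold segmentPairing
  rw [← integral_sub (integrable_segmentPairing i hg hζ) (integrable_segmentPairing i hk hζ)]
  simp only [← mul_sub]
  have := norm_integral_le_of_norm_le_const (μ := segmentMeasure n)
    (f := fun z : ℝ × Vec n => z.2 i * ((∫ x, g x * ζ (x + proj (-(z.1 • z.2)))) -
      ∫ x, k x * ζ (x + proj (-(z.1 • z.2))))) (C := (∫ x, |g x - k x|) * C) ?_
  · simpa using this
  · filter_upwards [ae_mem_segmentMeasure] with z hz
    rw [norm_mul, ← integral_sub (hint hg _) (hint hk _)]
    refine (mul_le_of_le_one_left (norm_nonneg _) (abs_apply_le_of_mem_cube hz i)).trans ?_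
    simp only [← sub_mul]
    exact abs_integral_mul_le (hg.sub hk) hC _

/-- For `g ∈ L^p` with `p > n`, the segment averages of `g` are a continuous function. -/
theorem exists_continuousMap_segmentPairing {p : ℝ} (hp1 : 1 ≤ p) (hpn : n < p) (i : Fin n)
    {g : Torus n → ℝ} (hg : MemLp g (ENNReal.ofReal p)) :
    ∃ τ : C(Torus n, ℝ), ∀ ζ : Torus n → ℝ, Continuous ζ →
      segmentPairing i g ζ = ∫ x, τ x * ζ x := by
  obtain ⟨C, hC0, hC⟩ := exists_abs_segmentAverage_le hp1 hpn
  have hp1' : 1 ≤ ENNReal.ofReal p := by simpa using hp1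
  have hgi : Integrable g := hg.integrable hp1'
  have hε : ∀ k : ℕ, ENNReal.ofReal (1 / ((k : ℝ) + 1)) ≠ 0 := fun k => by
    simp only [ne_eq, ENNReal.ofReal_eq_zero, not_le]; positivity
  choose b hb hbm using fun k : ℕ =>
    hg.exists_boundedContinuous_eLpNorm_sub_le ENNReal.ofReal_ne_top (hε k)
  have hL1 : ∀ k, ∫ x, |g x - b k x| ≤ 1 / ((k : ℝ) + 1) := fun k => by
    have h1 : ∫ x, |g x - b k x| = (eLpNorm (g - ⇑(b k)) 1 volume).toReal := by
      rw [eLpNorm_one_eq_lintegral_enorm]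
      exact integral_norm_eq_lintegral_enorm (hg.1.sub (hbm k).1)
    rw [h1]
    refine ENNReal.toReal_le_of_le_ofReal (by positivity) (le_trans ?_ (hb k))
    exact eLpNorm_le_eLpNorm_of_exponent_le hp1' (hg.1.sub (hbm k).1)
  have hbb : ∀ k l, (eLpNorm (fun x => b k x - b l x) (ENNReal.ofReal p) volume).toReal ≤
      1 / ((k : ℝ) + 1) + 1 / ((l : ℝ) + 1) := fun k l => by
    have h1 : (fun x => b k x - b l x) = (g - ⇑(b l)) - (g - ⇑(b k)) := by
      ext x; simp
    have h2 := (eLpNorm_sub_le (hg.1.sub (hbm l).1) (hg.1.sub (hbm k).1) hp1').trans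
      (add_le_add (hb l) (hb k))
    rw [← ENNReal.ofReal_add (by positivity) (by positivity)] at h2
    rw [h1, add_comm]
    exact ENNReal.toReal_le_of_le_ofReal (by positivity) h2
  let τ : ℕ → C(Torus n, ℝ) := fun k => ⟨segmentAverage i (b k),
    continuous_segmentAverage i (b k).continuous⟩
  have h0 : Tendsto (fun k : ℕ => 1 / ((k : ℝ) + 1)) atTop (𝓝 0) :=
    tendsto_one_div_add_atTop_nhds_zero_nat
  -- The sup norm of a segment average is controlled by an `L^p` norm, so `L^p` approximation by
  -- continuous `b k` gives uniform convergence of the averages.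
  have hτ : CauchySeq τ := by
    refine cauchySeq_of_le_tendsto_0 (fun N : ℕ => C * (1 / ((N : ℝ) + 1) + 1 / ((N : ℝ) + 1)))
      (fun k l N hk hl => ?_) (by simpa using (h0.add h0).const_mul C)
    rw [ContinuousMap.dist_le (by positivity)]
    intro x
    change |segmentAverage i (b k) x - segmentAverage i (b l) x| ≤ _
    rw [← segmentAverage_sub i (b k).continuous (b l).continuous]
    refine (hC i _ ((b k).continuous.sub (b l).continuous) x).trans ?_
    refine mul_le_mul_of_nonneg_left ((hbb k l).trans (add_le_add ?_ ?_)) hC0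
    · exact Nat.one_div_le_one_div hk
    · exact Nat.one_div_le_one_div hl
  obtain ⟨σ, hσ⟩ := cauchySeq_tendsto_of_complete hτ
  refine ⟨σ, fun ζ hζ => ?_⟩
  obtain ⟨D, hD0, hD⟩ := exists_forall_abs_le hζ
  have hl1 : Tendsto (fun k => segmentPairing i (b k) ζ) atTop (𝓝 (segmentPairing i g ζ)) := by
    rw [tendsto_iff_dist_tendsto_zero]
    refine squeeze_zero (fun _ => dist_nonneg) (fun k => ?_) (g := fun k : ℕ => 1 / ((k : ℝ) + 1) * D)
      (by simpa only [zero_mul] using h0.mul_const D)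
    rw [dist_comm, Real.dist_eq]
    exact (abs_segmentPairing_sub_le i hgi ((hbm k).integrable hp1') hζ hD).trans
      (mul_le_mul_of_nonneg_right (hL1 k) hD0)
  have hl2 : Tendsto (fun k => segmentPairing i (b k) ζ) atTop (𝓝 (∫ x, σ x * ζ x)) := by
    simp only [segmentPairing_eq i (b _).continuous hζ]
    rw [tendsto_iff_dist_tendsto_zero]
    have hd : Tendsto (fun k => dist (τ k) σ * D) atTop (𝓝 0) := by
      simpa using (tendsto_iff_dist_tendsto_zero.1 hσ).mul_const D
    refine squeeze_zero (fun _ => dist_nonneg) (fun k => ?_) hd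
    have hc := continuous_segmentAverage i (b k).continuous
    rw [dist_eq_norm, ← integral_sub (integrable_of_continuous (by fun_prop))
      (integrable_of_continuous (by fun_prop))]
    have := norm_integral_le_of_norm_le_const (μ := (volume : Measure (Torus n)))
      (f := fun x => segmentAverage i (b k) x * ζ x - σ x * ζ x) (C := dist (τ k) σ * D)
      (.of_forall fun x => by
        rw [← sub_mul, norm_mul]
        exact mul_le_mul ((τ k).dist_apply_le_dist x) (hD x) (abs_nonneg _) dist_nonneg)
    simpa using this
  exact tendsto_nhds_unique hl1 hl2

instance : (volume : Measure (Torus n)).IsNegInvariant :=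
  Measure.IsAddHaarMeasure.isNegInvariant_of_regular _

/-- Morrey's embedding: `W^{1,p}(𝕋ⁿ) ⊆ C(𝕋ⁿ)` for `p > n`. -/
theorem exists_continuous_ae_eq {p : ℝ} (hp1 : 1 ≤ p) (hpn : n < p) {u : Torus n → ℝ}
    {g : Fin n → Torus n → ℝ} (hu : Integrable u) (h : ∀ i, HasWeakDeriv [i] u (g i))
    (hg : ∀ i, MemLp (g i) (ENNReal.ofReal p)) :
    ∃ u' : Torus n → ℝ, Continuous u' ∧ u =ᵐ[volume] u' := by
  have hp := continuous_proj (n := n)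
  choose τ hτ using fun i => exists_continuousMap_segmentPairing hp1 hpn i (hg i)
  -- Averaging `u (x + y) - u x` over `y` in the cube gives `∫ u - u x` on one side and the sum of
  -- the segment averages of the `g i` on the other.
  refine ⟨fun x => (∫ y, u y) - ∑ i, τ i x, by fun_prop, ?_⟩
  have hz : (fun x => (∫ y, u y) - u x - ∑ i, τ i x) =ᵐ[volume] 0 := by
    have hτi : Integrable fun x => ∑ i, τ i x := integrable_of_continuous (by fun_prop)
    have hci : Integrable fun x => (∫ y, u y) - u x := (integrable_const _).sub hu
    refine ae_eq_zero_of_integral_smooth (hci.sub hτi) fun ζ hζ => ?_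
    have cζ := hζ.hasGrad.continuous
    obtain ⟨D, hD0, hD⟩ := exists_forall_abs_le cζ
    have hmul : ∀ {w : Torus n → ℝ}, Integrable w → Integrable fun x => w x * ζ x := fun hw =>
      hw.mul_bdd (c := D) cζ.aestronglyMeasurable (.of_forall hD)
    simp only [sub_mul]
    rw [integral_sub (by simpa only [sub_mul] using hmul hci) (hmul hτi),
      integral_sub (hmul (integrable_const _)) (hmul hu), integral_const_mul, sub_eq_zero]
    have hI : (∫ y in cube n, ∫ x, u x * ζ (x + proj (-y))) = (∫ y, u y) * ∫ x, ζ x := by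
      rw [integral_integral_swap]
      · rw [← integral_mul_const]
        refine integral_congr_ae (.of_forall fun x => ?_)
        simp only [integral_const_mul, proj_neg]
        congr 1
        rw [← integral_sub_left_eq_self ζ volume x,
          ← measurePreserving_proj.map_eq, integral_map hp.aemeasurable
            (Continuous.aestronglyMeasurable (by fun_prop))]
        simp only [sub_eq_add_neg]
      · refine Integrable.mul_bdd (c := D) (f := fun z : Vec n × Torus n => u z.2)
          (hu.comp_snd _) (Continuous.aestronglyMeasurable (by fun_prop)) (.of_forall fun z => hD _)
    have hII : (∫ y in cube n, ∫ x, u x * ζ (x + proj (-y))) - ∫ x, u x * ζ x =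
        ∑ i, segmentPairing i (g i) ζ := by
      have e1 : (∫ x, u x * ζ x) = ∫ y in cube n, ∫ x, u x * ζ x := by simp
      rw [e1, ← integral_sub]
      · simp only [integral_mul_translate_sub h hu hζ]
        unfold segmentPairing
        rw [← integral_finsetSum _ fun i _ => integrable_segmentPairing i (h i).integrable_right cζ]
        unfold segmentMeasure
        rw [integral_prod_symm]
        exact integrable_finsetSum _ fun i _ =>
          integrable_segmentPairing i (h i).integrable_right cζ
      · exact Integrable.of_bound (C := (∫ x, |u x|) * D)
          ((continuous_integral_mul_translate hu cζ).comp
            (by fun_prop : Continuous fun y : Vec n => proj (-y))).aestronglyMeasurable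
          (.of_forall fun y => abs_integral_mul_le hu hD _)
      · exact integrable_const _
    rw [← hI, hII]
    simp only [hτ _ ζ cζ, Finset.sum_mul]
    rw [integral_finsetSum _ fun i _ => integrable_of_continuous (by fun_prop)]
  filter_upwards [hz] with x hx
  simp only [Pi.zero_apply] at hx
  linarith

/-- A gradient field in `W^{2,p}`, `p > n`, has a continuously differentiable representative which
is the gradient of a `C²` function. -/
theorem IsGradientW2.exists_hasGrad {p : ℝ≥0∞} (hp : (n : ℝ≥0∞) < p) {Φ : Torus n → Vec n}
    (hΦ : IsGradientW2 p Φ) :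
    ∃ (φ : Torus n → ℝ) (G : Fin n → Torus n → ℝ) (A : Fin n → Fin n → Torus n → ℝ),
      HasGrad φ G ∧ (∀ i, HasGrad (G i) (A i)) ∧ ∀ᵐ x, ∀ i, Φ x i = G i x := by
  -- For `n = 0` the exponent may be below `1`, but there are no components to treat.
  rcases Nat.eq_zero_or_pos n with rfl | hn
  · exact ⟨fun _ => 0, fun _ _ => 0, fun _ _ _ => 0, .const 0, fun _ => .const 0,
      .of_forall fun x i => i.elim0⟩
  -- Capping `p` at `n + 1` provides a finite exponent when `p = ∞`.
  obtain ⟨q, hq1, hqn, hqp⟩ : ∃ q : ℝ, 1 ≤ q ∧ n < q ∧ ENNReal.ofReal q ≤ p := by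
    have hn1 : (1 : ℝ) ≤ n := by exact_mod_cast hn
    have hmin : min p (n + 1) ≠ ⊤ := ne_top_of_le_ne_top (by simp) (min_le_right _ _)
    have hlt : (n : ℝ) < (min p (n + 1)).toReal := by
      rw [← ENNReal.toReal_natCast]
      refine ENNReal.toReal_strict_mono hmin (lt_min hp ?_)
      exact_mod_cast Nat.lt_succ_self n
    exact ⟨_, hn1.trans hlt.le, hlt, (ENNReal.ofReal_toReal hmin).trans_le (min_le_left _ _)⟩
  obtain ⟨⟨φ, hφi, hφ⟩, hS⟩ := hΦ
  choose v hvp hv using fun j i => hS j [i] (by simp)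
  choose w hwp hw using fun j i k => hS j [i, k] (by simp)
  -- Morrey is applied three times, downwards: to the first derivatives of `Φ`, to `Φ`, and to `φ`.
  have hA : ∀ j i, ∃ A : Torus n → ℝ, Continuous A ∧ v j i =ᵐ[volume] A := fun j i =>
    exists_continuous_ae_eq hq1 hqn (hv j i).integrable_right
      (fun k => (hv j i).tail (hw j i k)) fun k => (hwp j i k).mono_exponent hqp
  choose A cA hvA using hA
  have hG : ∀ j, ∃ G : Torus n → ℝ, Continuous G ∧ (fun x => Φ x j) =ᵐ[volume] G := fun j =>
    exists_continuous_ae_eq hq1 hqn (hφ j).integrable_right (hv j)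
      fun i => (hvp j i).mono_exponent hqp
  choose G cG hΦG using hG
  obtain ⟨φ', cφ', hφ'⟩ := exists_continuous_ae_eq hq1 hqn hφi hφ fun i => by
    obtain ⟨C, -, hC⟩ := exists_forall_abs_le (cG i)
    exact (memLp_congr_ae (hΦG i)).2 (MemLp.of_bound (cG i).aestronglyMeasurable C (.of_forall hC))
  refine ⟨φ', G, A, hasGrad_of_hasWeakDeriv cφ' cG fun i => (hφ i).congr hφ' (hΦG i),
    fun j => hasGrad_of_hasWeakDeriv (cG j) (cA j) fun i => (hv j i).congr (hΦG j) (hvA j i), ?_⟩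
  rw [ae_all_iff]
  exact hΦG

/-! ### The logarithm of the Jacobian determinant -/

section LogDet

variable {ι : Type*} [Fintype ι] [DecidableEq ι]

/-- Factoring out `1 + t • M` reduces to the expansion `det (1 + r N) = 1 + r tr N + O(r²)` at `r =
0`. -/
theorem hasDerivAt_log_det (M : Matrix ι ι ℝ) {t : ℝ} (ht : 0 < (1 + t • M).det) :
    HasDerivAt (fun s : ℝ => Real.log (1 + s • M).det) ((1 + t • M)⁻¹ * M).trace t := by
  have hu : IsUnit (1 + t • M).det := ht.ne'.isUnit
  set N := (1 + t • M)⁻¹ * M with hN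
  have hfac : ∀ s : ℝ, (1 + s • M).det = (1 + t • M).det * (1 + (s - t) • N).det := fun s => by
    rw [← Matrix.det_mul, mul_add, mul_one, mul_smul_comm, hN, ← mul_assoc,
      Matrix.mul_nonsing_inv _ hu, one_mul, sub_smul]
    congr 1
    abel
  have h0 : HasDerivAt (fun r : ℝ => (1 + r • N).det) N.trace 0 := by
    rw [funext fun r : ℝ => Matrix.det_one_add_smul r N]
    set q := (1 + (Polynomial.X : Polynomial ℝ) • N.map Polynomial.C).det.divX.divX
    have := (((hasDerivAt_id (0 : ℝ)).const_mul N.trace).const_add 1).add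
      ((q.hasDerivAt 0).mul (hasDerivAt_pow 2 (0 : ℝ)))
    exact this.congr_deriv (by simp)
  have h1 : HasDerivAt (fun s : ℝ => (1 + (s - t) • N).det) N.trace t := by
    have := HasDerivAt.comp t (h₂ := fun r : ℝ => (1 + r • N).det) (h := fun s : ℝ => s - t)
      (by rwa [sub_self]) ((hasDerivAt_id t).sub_const t)
    exact this.congr_deriv (mul_one _)
  have h2 : HasDerivAt (fun s : ℝ => (1 + s • M).det) ((1 + t • M).det * N.trace) t := by
    rw [funext hfac]
    exact h1.const_mul (1 + t • M).det
  exact (h2.log ht.ne').congr_deriv (by field_simp)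

theorem continuousAt_inv_one_add_smul {t : ℝ} {M : Matrix ι ι ℝ} (ht : (1 + t • M).det ≠ 0) :
    ContinuousAt (fun z : ℝ × Matrix ι ι ℝ => (1 + z.1 • z.2)⁻¹) (t, M) := by
  have h1 : ContinuousAt (Ring.inverse : ℝ → ℝ) (1 + t • M).det := by
    rw [Ring.inverse_eq_inv']
    exact continuousAt_inv₀ ht
  exact ContinuousAt.comp (f := fun z : ℝ × Matrix ι ι ℝ => 1 + z.1 • z.2)
    (continuousAt_matrix_inv _ h1) (Continuous.continuousAt (by fun_prop))

theorem continuousAt_trace_inv {t : ℝ} {M : Matrix ι ι ℝ} (ht : (1 + t • M).det ≠ 0) :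
    ContinuousAt (fun z : ℝ × Matrix ι ι ℝ => ((1 + z.1 • z.2)⁻¹ * z.2).trace) (t, M) := by
  have hl : Continuous fun q : Matrix ι ι ℝ × Matrix ι ι ℝ => (q.1 * q.2).trace :=
    (continuous_fst.matrix_mul continuous_snd).matrix_trace
  exact ContinuousAt.comp (f := fun z : ℝ × Matrix ι ι ℝ => ((1 + z.1 • z.2)⁻¹, z.2))
    hl.continuousAt ((continuousAt_inv_one_add_smul ht).prodMk continuousAt_snd)

theorem continuousAt_trace_inv_mul_inv {t : ℝ} {M : Matrix ι ι ℝ} (ht : (1 + t • M).det ≠ 0) :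
    ContinuousAt (fun z : ℝ × Matrix ι ι ℝ =>
      -((1 + z.1 • z.2)⁻¹ * z.2 * ((1 + z.1 • z.2)⁻¹ * z.2)).trace) (t, M) := by
  have hm : Continuous fun q : Matrix ι ι ℝ × Matrix ι ι ℝ => q.1 * q.2 :=
    continuous_fst.matrix_mul continuous_snd
  have hl : Continuous fun q : Matrix ι ι ℝ × Matrix ι ι ℝ => -(q.1 * q.2 * (q.1 * q.2)).trace :=
    (hm.matrix_mul hm).matrix_trace.neg
  exact ContinuousAt.comp (f := fun z : ℝ × Matrix ι ι ℝ => ((1 + z.1 • z.2)⁻¹, z.2))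
    hl.continuousAt ((continuousAt_inv_one_add_smul ht).prodMk continuousAt_snd)

/-- By the resolvent identity the difference quotient is an explicit expression, continuous in `s`
up to `s = t`. -/
theorem hasDerivAt_trace_inv (M : Matrix ι ι ℝ) {t : ℝ} (ht : (1 + t • M).det ≠ 0) :
    HasDerivAt (fun s : ℝ => ((1 + s • M)⁻¹ * M).trace)
      (-((1 + t • M)⁻¹ * M * ((1 + t • M)⁻¹ * M)).trace) t := by
  have hc : ContinuousAt (fun s : ℝ => (1 + s • M)⁻¹) t :=
    ContinuousAt.comp (f := fun s : ℝ => (s, M)) (continuousAt_inv_one_add_smul ht)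
      (Continuous.continuousAt (by fun_prop))
  have hq : ContinuousAt (fun s : ℝ => -((1 + s • M)⁻¹ * M * ((1 + t • M)⁻¹ * M)).trace) t := by
    have hl : Continuous fun B : Matrix ι ι ℝ => -(B * M * ((1 + t • M)⁻¹ * M)).trace := by fun_prop
    exact hl.continuousAt.comp hc
  have hev : ∀ᶠ s in 𝓝 t, (1 + s • M).det ≠ 0 :=
    (Continuous.continuousAt (by fun_prop : Continuous fun s : ℝ => (1 + s • M).det)).eventually_ne ht
  rw [hasDerivAt_iff_tendsto_slope]
  refine (hq.tendsto.mono_left nhdsWithin_le_nhds).congr' ?_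
  filter_upwards [nhdsWithin_le_nhds hev, self_mem_nhdsWithin] with s hs hst
  have hst' : s - t ≠ 0 := sub_ne_zero.2 hst
  have hinv : (1 + s • M)⁻¹ - (1 + t • M)⁻¹ =
      -((s - t) • ((1 + s • M)⁻¹ * M * (1 + t • M)⁻¹)) := by
    calc (1 + s • M)⁻¹ - (1 + t • M)⁻¹
        = (1 + s • M)⁻¹ * ((1 + t • M) - (1 + s • M)) * (1 + t • M)⁻¹ := by
          rw [mul_sub, sub_mul, mul_assoc, Matrix.mul_nonsing_inv _ ht.isUnit,
            Matrix.nonsing_inv_mul _ hs.isUnit, mul_one, one_mul]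
      _ = _ := by
          rw [add_sub_add_left_eq_sub, ← sub_smul, mul_smul_comm, smul_mul_assoc, ← neg_smul,
            neg_sub]
  rw [slope_def_field, ← Matrix.trace_sub, ← sub_mul, hinv, neg_mul, Matrix.trace_neg,
    smul_mul_assoc, Matrix.trace_smul, smul_eq_mul, mul_assoc ((1 + s • M)⁻¹ * M)]
  field_simp

end LogDet

/-- The matrix with the entries `A i j x`. -/
def matrixAt (A : Fin n → Fin n → Torus n → ℝ) (x : Torus n) : Matrix (Fin n) (Fin n) ℝ :=
  Matrix.of fun i j => A i j x

/-- The Jacobian determinant of `id + t G` if `A` is the derivative of `G`. -/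
def jacobian (A : Fin n → Fin n → Torus n → ℝ) (t : ℝ) (x : Torus n) : ℝ :=
  (1 + t • matrixAt A x).det

theorem continuous_matrixAt {A : Fin n → Fin n → Torus n → ℝ} (hA : ∀ i j, Continuous (A i j)) :
    Continuous (matrixAt A) :=
  continuous_matrix fun i j => hA i j

theorem continuous_jacobian {A : Fin n → Fin n → Torus n → ℝ} (hA : ∀ i j, Continuous (A i j)) :
    Continuous fun z : ℝ × Torus n => jacobian A z.1 z.2 := by
  have := continuous_matrixAt hA
  unfold jacobian
  fun_prop

/-- The Jacobian is `1` at `t = 0`; compactness makes the neighbourhood uniform in `x`. -/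
theorem eventually_jacobian_pos {A : Fin n → Fin n → Torus n → ℝ}
    (hA : ∀ i j, Continuous (A i j)) : ∀ᶠ t in 𝓝 (0 : ℝ), ∀ x, 0 < jacobian A t x := by
  have := (isCompact_univ (X := Torus n)).eventually_forall_of_forall_eventually (x₀ := (0 : ℝ))
    (P := fun t x => 0 < jacobian A t x) fun x _ => by
      refine (continuous_jacobian hA).continuousAt.eventually_const_lt ?_
      simp [jacobian]
  simpa using this

theorem hasSecondDeriv_integral_log_jacobian {A : Fin n → Fin n → Torus n → ℝ}
    (hA : ∀ i j, Continuous (A i j)) (μ : Measure (Torus n)) [IsFiniteMeasure μ] :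
    ∃ k : ℝ → ℝ, (∀ᶠ t in 𝓝 (0 : ℝ),
      HasDerivAt (fun t => ∫ x, Real.log (jacobian A t x) ∂μ) (k t) t) ∧
      HasDerivAt k (-∫ x, ∑ i, ∑ j, A i j x * A j i x ∂μ) 0 := by
  obtain ⟨O, hOpos, hO, h0⟩ := eventually_nhds_iff.1 (eventually_jacobian_pos hA)
  have hM := continuous_matrixAt hA
  have hJ := continuous_jacobian hA
  have hpair : Continuous fun z : ℝ × Torus n => (z.1, matrixAt A z.2) :=
    continuous_fst.prodMk (hM.comp continuous_snd)
  have hK₁ : ContinuousOn (fun z : ℝ × Torus n =>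
      ((1 + z.1 • matrixAt A z.2)⁻¹ * matrixAt A z.2).trace) (O ×ˢ Set.univ) := fun z hz =>
    (ContinuousAt.comp (f := fun z : ℝ × Torus n => (z.1, matrixAt A z.2))
      (continuousAt_trace_inv (hOpos z.1 hz.1 z.2).ne') hpair.continuousAt).continuousWithinAt
  have hK₂ : ContinuousOn (fun z : ℝ × Torus n =>
      -((1 + z.1 • matrixAt A z.2)⁻¹ * matrixAt A z.2 *
        ((1 + z.1 • matrixAt A z.2)⁻¹ * matrixAt A z.2)).trace) (O ×ˢ Set.univ) := fun z hz =>
    (ContinuousAt.comp (f := fun z : ℝ × Torus n => (z.1, matrixAt A z.2))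
      (continuousAt_trace_inv_mul_inv (hOpos z.1 hz.1 z.2).ne')
      hpair.continuousAt).continuousWithinAt
  refine ⟨fun t => ∫ x, ((1 + t • matrixAt A x)⁻¹ * matrixAt A x).trace ∂μ, ?_, ?_⟩
  · filter_upwards [hO.mem_nhds h0] with t ht
    refine hasDerivAt_integral_of_continuousOn (K := fun t x => Real.log (jacobian A t x))
      (K' := fun t x => ((1 + t • matrixAt A x)⁻¹ * matrixAt A x).trace) hO (fun t ht => ?_) hK₁
      (fun t ht x => hasDerivAt_log_det _ (hOpos t ht x)) ht
    exact (hJ.comp (by fun_prop : Continuous fun x : Torus n => (t, x))).log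
      fun x => (hOpos t ht x).ne'
  · refine (hasDerivAt_integral_of_continuousOn
      (K := fun t x => ((1 + t • matrixAt A x)⁻¹ * matrixAt A x).trace)
      (K' := fun t x => -((1 + t • matrixAt A x)⁻¹ * matrixAt A x *
        ((1 + t • matrixAt A x)⁻¹ * matrixAt A x)).trace) hO (fun t ht => ?_) hK₂
      (fun t ht x => hasDerivAt_trace_inv _ (hOpos t ht x).ne') h0).congr_deriv ?_
    · exact hK₁.comp_continuous (f := fun x : Torus n => (t, x)) (by fun_prop) fun x => ⟨ht, trivial⟩
    · rw [← integral_neg]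
      refine integral_congr_ae (.of_forall fun x => ?_)
      simp [Matrix.trace, Matrix.mul_apply, matrixAt]

/-! ### The displacement map -/

/-- The remainder is the integral along the segment of `v` paired with the increment of the
gradient, which is small by continuity. -/
theorem HasGrad.hasFDerivAt_lift {u : Torus n → ℝ} {g : Fin n → Torus n → ℝ} (h : HasGrad u g)
    (x : Vec n) : HasFDerivAt (fun x : Vec n => u (proj x))
      (∑ i, g i (proj x) • (EuclideanSpace.proj i : Vec n →L[ℝ] ℝ)) x := by
  have hp := continuous_proj (n := n)
  have hg := h.continuous_grad
  rw [hasFDerivAt_iff_isLittleO_nhds_zero, Asymptotics.isLittleO_iff]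
  intro c hc
  have hev : ∀ᶠ w in 𝓝 (0 : Vec n), ∀ i, |g i (proj (x + w)) - g i (proj x)| < c / (n + 1) := by
    rw [eventually_all]
    intro i
    have : Continuous fun w : Vec n => |g i (proj (x + w)) - g i (proj x)| := by fun_prop
    refine this.continuousAt.eventually_lt_const ?_
    simp only [add_zero, sub_self, abs_zero]
    positivity
  obtain ⟨δ, hδ, hball⟩ := Metric.eventually_nhds_iff_ball.1 hev
  filter_upwards [Metric.ball_mem_nhds 0 hδ] with v hv
  have hcs : ∀ b : ℝ → Fin n → ℝ, (∀ s i, b s i = g i (proj x + proj (s • v)) - g i (proj x)) →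
      u (proj (x + v)) - u (proj x) - (∑ i, g i (proj x) • (EuclideanSpace.proj i : Vec n →L[ℝ] ℝ)) v
        = ∫ s in Set.Ioc (0 : ℝ) 1, ∑ i, v i * b s i := by
    intro b hb
    obtain ⟨C, -, hC⟩ := exists_forall_abs_le (by fun_prop : Continuous fun y => ∑ i, v i * g i y)
    simp only [hb, mul_sub, Finset.sum_sub_distrib]
    rw [proj_add, h.sub_eq_integral, integral_sub
      (Integrable.of_bound (Continuous.aestronglyMeasurable (by fun_prop)) C
        (.of_forall fun s => hC _)) (integrable_const _)]
    simp [mul_comm]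
  rw [hcs _ fun _ _ => rfl]
  have := norm_integral_le_of_norm_le_const (μ := volume.restrict (Set.Ioc (0 : ℝ) 1))
    (f := fun s : ℝ => ∑ i, v i * (g i (proj x + proj (s • v)) - g i (proj x))) (C := c * ‖v‖) ?_
  · simpa using this
  · filter_upwards [ae_restrict_mem measurableSet_Ioc] with s hs
    refine (norm_sum_le _ _).trans ?_
    have hterm : ∀ i ∈ Finset.univ, ‖v i * (g i (proj x + proj (s • v)) - g i (proj x))‖ ≤
        ‖v‖ * (c / (n + 1)) := fun i _ => by
      rw [norm_mul]
      refine mul_le_mul (PiLp.norm_apply_le v i) ?_ (norm_nonneg _) (norm_nonneg _)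
      rw [← proj_add]
      refine (hball (s • v) ?_ i).le
      rw [mem_ball_zero_iff] at hv ⊢
      rw [norm_smul, Real.norm_of_nonneg hs.1.le]
      exact (mul_le_of_le_one_left (norm_nonneg _) hs.2).trans_lt hv
    refine (Finset.sum_le_card_nsmul _ _ _ hterm).trans ?_
    simp only [Finset.card_univ, Fintype.card_fin, nsmul_eq_mul]
    have : (n : ℝ) * (c / (n + 1)) ≤ c := by
      rw [mul_div_assoc', div_le_iff₀ (by positivity)]
      nlinarith
    nlinarith [norm_nonneg v]

/-- The vector field with the components `G i`. -/
def fieldOf (G : Fin n → Torus n → ℝ) (x : Torus n) : Vec n := WithLp.toLp 2 fun i => G i x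

theorem continuous_fieldOf {G : Fin n → Torus n → ℝ} (hG : ∀ i, Continuous (G i)) :
    Continuous (fieldOf G) :=
  (PiLp.continuous_toLp 2 _).comp (continuous_pi hG)

section Displacement

variable {G : Fin n → Torus n → ℝ} {A : Fin n → Fin n → Torus n → ℝ}

theorem hasFDerivAt_fieldOf (hG : ∀ i, HasGrad (G i) (A i)) (x : Vec n) :
    HasFDerivAt (fun x : Vec n => fieldOf G (proj x))
      (Matrix.toEuclideanCLM (𝕜 := ℝ) (matrixAt A (proj x)) : Vec n →L[ℝ] Vec n) x := by
  rw [← hasFDerivWithinAt_univ, hasFDerivWithinAt_euclidean]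
  intro i
  rw [hasFDerivWithinAt_univ]
  refine ((hG i).hasFDerivAt_lift x).congr_fderiv ?_
  ext v
  simp [Matrix.ofLp_toEuclideanCLM, Matrix.mulVec, dotProduct, matrixAt]

theorem exists_lipschitzWith_fieldOf (hG : ∀ i, HasGrad (G i) (A i)) :
    ∃ K, LipschitzWith K fun x : Vec n => fieldOf G (proj x) := by
  have hM := continuous_matrixAt fun i => (hG i).continuous_grad
  have hc : Continuous fun x : Torus n =>
      ‖(Matrix.toEuclideanCLM (𝕜 := ℝ) (matrixAt A x) : Vec n →L[ℝ] Vec n)‖ :=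
    (((Matrix.toEuclideanCLM (n := Fin n) (𝕜 := ℝ)).toAlgEquiv.toLinearMap
      ).continuous_of_finiteDimensional.comp hM).norm
  obtain ⟨C, hC0, hC⟩ := exists_forall_abs_le hc
  refine ⟨⟨C, hC0⟩, lipschitzWith_of_nnnorm_fderiv_le
    (fun x => (hasFDerivAt_fieldOf hG x).differentiableAt) fun x => ?_⟩
  rw [(hasFDerivAt_fieldOf hG x).fderiv]
  exact NNReal.coe_le_coe.1 ((le_abs_self _).trans (hC (proj x)))

/-- The lift of `id + t G` to `ℝⁿ`. -/
def liftDisplacement (G : Fin n → Torus n → ℝ) (t : ℝ) (x : Vec n) : Vec n :=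
  x + t • fieldOf G (proj x)

/-- Equivariance under the lattice, by which statements about the lift descend to the torus. -/
theorem liftDisplacement_add (t : ℝ) (x : Vec n) {k : Vec n} (hk : proj k = 0) :
    liftDisplacement G t (k + x) = k + liftDisplacement G t x := by
  simp [liftDisplacement, proj_add, hk, add_assoc]

theorem proj_liftDisplacement (t : ℝ) (x : Vec n) :
    proj (liftDisplacement G t x) = proj x + proj (t • fieldOf G (proj x)) := by
  rw [liftDisplacement, proj_add]

theorem hasFDerivAt_liftDisplacement (hG : ∀ i, HasGrad (G i) (A i)) (t : ℝ) (x : Vec n) :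
    HasFDerivAt (liftDisplacement G t)
      (Matrix.toEuclideanCLM (𝕜 := ℝ) (1 + t • matrixAt A (proj x)) : Vec n →L[ℝ] Vec n) x := by
  have := (hasFDerivAt_id x).add ((hasFDerivAt_fieldOf hG x).const_smul t)
  refine this.congr_fderiv ?_
  rw [map_add, map_one, map_smul]
  rfl

theorem det_toEuclideanCLM (M : Matrix (Fin n) (Fin n) ℝ) :
    (Matrix.toEuclideanCLM (𝕜 := ℝ) M : Vec n →L[ℝ] Vec n).det = M.det := by
  rw [ContinuousLinearMap.det, Matrix.coe_toEuclideanCLM_eq_toEuclideanLin,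
    Matrix.toEuclideanLin_eq_toLin_orthonormal, LinearMap.det_toLin]

/-- For `|t| K < 1` the lift is the identity plus a strict contraction. -/
theorem eventually_exists_homeomorph (hG : ∀ i, HasGrad (G i) (A i)) :
    ∀ᶠ t in 𝓝 (0 : ℝ), ∃ e : Vec n ≃ₜ Vec n, ⇑e = liftDisplacement G t := by
  obtain ⟨K, hK⟩ := exists_lipschitzWith_fieldOf hG
  have hev : ∀ᶠ t in 𝓝 (0 : ℝ), ‖t‖₊ * K < 1 := by
    have : Continuous fun t : ℝ => ‖t‖₊ * K := by fun_prop
    exact this.continuousAt.eventually_lt_const (by simp)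
  filter_upwards [hev] with t ht
  have happ : ApproximatesLinearOn (liftDisplacement G t)
      (ContinuousLinearEquiv.refl ℝ (Vec n) : Vec n →L[ℝ] Vec n) Set.univ (‖t‖₊ * K) := by
    intro x _ y _
    have : liftDisplacement G t x - liftDisplacement G t y -
        (ContinuousLinearEquiv.refl ℝ (Vec n) : Vec n →L[ℝ] Vec n) (x - y) =
        t • (fieldOf G (proj x) - fieldOf G (proj y)) := by
      simp only [liftDisplacement, ContinuousLinearEquiv.coe_coe, ContinuousLinearEquiv.coe_refl',
        id, smul_sub]
      abel
    rw [this, norm_smul, NNReal.coe_mul, coe_nnnorm, mul_assoc]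
    exact mul_le_mul_of_nonneg_left (hK.norm_sub_le x y) (norm_nonneg _)
  refine ⟨happ.toHomeomorph _ ?_, rfl⟩
  -- The identity has norm `1` only on a nontrivial space, so `n = 0` is separate.
  rcases subsingleton_or_nontrivial (Vec n) with h | h
  · exact Or.inl h
  · refine Or.inr (ht.trans_le ?_)
    have : ‖((ContinuousLinearEquiv.refl ℝ (Vec n)).symm : Vec n →L[ℝ] Vec n)‖₊ = 1 :=
      ContinuousLinearMap.nnnorm_id
    rw [this, inv_one]

theorem proj_eq_zero_of_mem_span {k : Vec n}
    (hk : k ∈ Submodule.span ℤ (Set.range (EuclideanSpace.basisFun (Fin n) ℝ).toBasis)) :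
    proj k = 0 := by
  induction hk using Submodule.span_induction with
  | mem x hx =>
    obtain ⟨i, rfl⟩ := hx
    ext j
    by_cases hij : j = i
    · subst hij
      simp [proj]
    · simp [proj, hij]
  | zero => exact proj_zero
  | add x y _ _ hx hy => rw [proj_add, hx, hy, add_zero]
  | smul a x _ hx =>
    have : proj (a • x) = a • proj x := by
      ext j
      simp [proj]
    rw [this, hx, smul_zero]

theorem fundamentalDomain_eq_cube :
    ZSpan.fundamentalDomain (EuclideanSpace.basisFun (Fin n) ℝ).toBasis = cube n := by
  ext x
  simp [ZSpan.mem_fundamentalDomain, cube]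

/-- The change of variables `y = x + t G(x)` on the torus. -/
theorem lintegral_jacobian_mul (hG : ∀ i, HasGrad (G i) (A i)) {t : ℝ} {e : Vec n ≃ₜ Vec n}
    (he : ⇑e = liftDisplacement G t) (hJ : ∀ x, 0 < jacobian A t x) {h : Torus n → ℝ≥0∞}
    (hh : Measurable h) :
    ∫⁻ x, ENNReal.ofReal (jacobian A t x) * h (x + proj (t • fieldOf G x)) = ∫⁻ x, h x := by
  have hp := continuous_proj (n := n)
  have cJ : Continuous (jacobian A t) :=
    (continuous_jacobian fun i => (hG i).continuous_grad).comp
      (by fun_prop : Continuous fun x : Torus n => (t, x))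
  have cG := continuous_fieldOf fun i => (hG i).continuous
  have hd := hasFDerivAt_liftDisplacement hG t
  set b := (EuclideanSpace.basisFun (Fin n) ℝ).toBasis
  have : VAddInvariantMeasure (Submodule.span ℤ (Set.range b)) (Vec n) volume :=
    ⟨fun k B _ => measure_preimage_add volume (k : Vec n) B⟩
  have hdom : IsAddFundamentalDomain (Submodule.span ℤ (Set.range b)) (cube n)
      (volume : Measure (Vec n)) := by
    rw [← fundamentalDomain_eq_cube]
    exact ZSpan.isAddFundamentalDomain b volume
  have hqmp : Measure.QuasiMeasurePreserving e.toEquiv.symm volume volume := by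
    have hm : Measurable e.toEquiv.symm := e.symm.measurable
    refine ⟨hm, Measure.AbsolutelyContinuous.mk fun B hB h0 => ?_⟩
    rw [Measure.map_apply hm hB]
    have himg : e.toEquiv.symm ⁻¹' B = liftDisplacement G t '' B := by
      rw [← he]
      exact (e.toEquiv.image_eq_preimage_symm B).symm
    rw [himg]
    exact addHaar_image_eq_zero_of_differentiableOn_of_addHaar_eq_zero volume
      (fun x _ => (hd x).differentiableAt.differentiableWithinAt) h0
  -- The displaced cube is again a fundamental domain, since the lift commutes with the lattice. A
  -- periodic function thus has the same integral over it as over the cube.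
  have hdom' : IsAddFundamentalDomain (Submodule.span ℤ (Set.range b))
      (liftDisplacement G t '' cube n) (volume : Measure (Vec n)) := by
    have := hdom.image_of_equiv e.toEquiv hqmp (Equiv.refl _) fun k x => by
      change e ((k : Vec n) + x) = (k : Vec n) + e x
      rw [he]
      exact liftDisplacement_add t x (proj_eq_zero_of_mem_span k.2)
    rw [← he]
    exact this
  have hinj : Set.InjOn (liftDisplacement G t) (cube n) := by
    rw [← he]
    exact e.injective.injOn
  calc ∫⁻ x, ENNReal.ofReal (jacobian A t x) * h (x + proj (t • fieldOf G x))
      = ∫⁻ y in cube n, ENNReal.ofReal (jacobian A t (proj y)) *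
          h (proj (liftDisplacement G t y)) := by
        rw [← measurePreserving_proj.lintegral_comp]
        · simp only [proj_liftDisplacement]
        · exact (cJ.measurable.ennreal_ofReal).mul
            (hh.comp (Continuous.measurable (by fun_prop)))
    _ = ∫⁻ y in liftDisplacement G t '' cube n, h (proj y) := by
        rw [lintegral_image_eq_lintegral_abs_det_fderiv_mul volume measurableSet_cube
          (fun x _ => (hd x).hasFDerivWithinAt) hinj]
        refine lintegral_congr fun y => ?_
        rw [det_toEuclideanCLM]
        change _ = ENNReal.ofReal |jacobian A t (proj y)| * _
        rw [abs_of_pos (hJ _)]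
    _ = ∫⁻ y in cube n, h (proj y) := by
        refine hdom'.setLIntegral_eq hdom _ fun k x => ?_
        change h (proj ((k : Vec n) + x)) = _
        rw [proj_add, proj_eq_zero_of_mem_span k.2, zero_add]
    _ = ∫⁻ x, h x := measurePreserving_proj.lintegral_comp hh

theorem bijective_displacement {t : ℝ} {e : Vec n ≃ₜ Vec n}
    (he : ⇑e = liftDisplacement G t) :
    Function.Bijective fun x : Torus n => x + proj (t • fieldOf G x) := by
  constructor
  · intro x y hxy
    obtain ⟨x, rfl⟩ := isOpenQuotientMap_proj.surjective x
    obtain ⟨y, rfl⟩ := isOpenQuotientMap_proj.surjective y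
    simp only [← proj_liftDisplacement] at hxy
    have hk : proj (liftDisplacement G t x - liftDisplacement G t y) = 0 := by
      rw [sub_eq_add_neg, proj_add, proj_neg, hxy, add_neg_cancel]
    have h1 := liftDisplacement_add (G := G) t y hk
    rw [sub_add_cancel, ← he] at h1
    rw [← e.injective h1, proj_add, he, hk, zero_add]
  · intro z
    obtain ⟨z, rfl⟩ := isOpenQuotientMap_proj.surjective z
    obtain ⟨x, rfl⟩ := e.surjective z
    exact ⟨proj x, by rw [he, proj_liftDisplacement]⟩

theorem entropy_withDensity {σ : Torus n → ℝ} (hσ : Continuous σ) (hpos : ∀ x, 0 < σ x) :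
    entropy (volume.withDensity fun x => ENNReal.ofReal (σ x)) =
      ((∫ x, Real.log (σ x) ∂volume.withDensity fun x => ENNReal.ofReal (σ x) : ℝ) : EReal) := by
  set P := (volume : Measure (Torus n)).withDensity fun x => ENNReal.ofReal (σ x) with hP
  have hfin : IsFiniteMeasure P :=
    isFiniteMeasure_withDensity_ofReal (integrable_of_continuous hσ).2
  have hac : P ≪ volume := withDensity_absolutelyContinuous _ _
  have hm : Measurable fun x => ENNReal.ofReal (σ x) := hσ.measurable.ennreal_ofReal
  have hlog : (fun x => Real.log (P.rnDeriv volume x).toReal) =ᵐ[P] fun x => Real.log (σ x) := by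
    filter_upwards [hac.ae_le (Measure.rnDeriv_withDensity volume hm)] with x hx
    rw [hP, hx, ENNReal.toReal_ofReal (hpos x).le]
  have hint : Integrable (fun x => Real.log (σ x)) P :=
    integrable_of_continuous (hσ.log fun x => (hpos x).ne')
  rw [entropy, if_pos ⟨hac, hint.congr hlog.symm⟩, integral_congr_ae hlog]

/-- The entropy of a displaced measure. -/
theorem eventually_entropy_map (hG : ∀ i, HasGrad (G i) (A i)) {ρ : Torus n → ℝ}
    (hρ : Continuous ρ) (hpos : ∀ x, 0 < ρ x) :
    ∀ᶠ t in 𝓝 (0 : ℝ),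
      entropy ((volume.withDensity fun x => ENNReal.ofReal (ρ x)).map
        fun x => x + proj (t • fieldOf G x)) =
      (((∫ x, Real.log (ρ x) ∂volume.withDensity fun x => ENNReal.ofReal (ρ x)) -
        ∫ x, Real.log (jacobian A t x) ∂volume.withDensity fun x => ENNReal.ofReal (ρ x) : ℝ) :
        EReal) := by
  filter_upwards [eventually_jacobian_pos fun i => (hG i).continuous_grad,
    eventually_exists_homeomorph hG] with t hJ ⟨e, he⟩
  have hp := continuous_proj (n := n)
  have cJ : Continuous (jacobian A t) :=
    (continuous_jacobian fun i => (hG i).continuous_grad).comp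
      (by fun_prop : Continuous fun x : Torus n => (t, x))
  have cG := continuous_fieldOf fun i => (hG i).continuous
  have cT : Continuous fun x : Torus n => x + proj (t • fieldOf G x) := by fun_prop
  let T : Torus n ≃ₜ Torus n := Continuous.homeoOfEquivCompactToT2
    (f := Equiv.ofBijective _ (bijective_displacement he)) cT
  have hT : ∀ x, T x = x + proj (t • fieldOf G x) := fun x => rfl
  set μ := (volume : Measure (Torus n)).withDensity fun x => ENNReal.ofReal (ρ x) with hμ
  have hfin : IsFiniteMeasure μ :=
    isFiniteMeasure_withDensity_ofReal (integrable_of_continuous hρ).2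
  have cq : Continuous fun x => ρ x / jacobian A t x := hρ.div cJ fun x => (hJ x).ne'
  have hq : ∀ x, 0 < ρ x / jacobian A t x := fun x => div_pos (hpos x) (hJ x)
  -- The density of the push-forward, determined by `σ (T x) * jacobian A t x = ρ x`.
  set σ : Torus n → ℝ := fun y => ρ (T.symm y) / jacobian A t (T.symm y) with hσ
  have cσ : Continuous σ := cq.comp T.symm.continuous
  have hmap : μ.map (fun x => x + proj (t • fieldOf G x)) =
      volume.withDensity fun x => ENNReal.ofReal (σ x) := by
    refine Measure.ext_of_lintegral _ fun h hh => ?_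
    have hhT : Measurable fun x => h (x + proj (t • fieldOf G x)) := hh.comp cT.measurable
    rw [lintegral_map hh cT.measurable, hμ,
      lintegral_withDensity_eq_lintegral_mul _ hρ.measurable.ennreal_ofReal hhT,
      lintegral_withDensity_eq_lintegral_mul _ cσ.measurable.ennreal_ofReal hh,
      ← lintegral_jacobian_mul hG he hJ (cσ.measurable.ennreal_ofReal.mul hh)]
    refine lintegral_congr fun x => ?_
    simp only [Pi.mul_apply, ← hT, hσ, T.symm_apply_apply]
    rw [← mul_assoc, ← ENNReal.ofReal_mul (hJ x).le, mul_div_cancel₀ _ (hJ x).ne']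
  have hlog : ∫ x, Real.log (σ x) ∂μ.map (fun x => x + proj (t • fieldOf G x)) =
      (∫ x, Real.log (ρ x) ∂μ) - ∫ x, Real.log (jacobian A t x) ∂μ := by
    rw [integral_map cT.aemeasurable
      (cσ.log fun x => (hq _).ne').aestronglyMeasurable,
      ← integral_sub (integrable_of_continuous (hρ.log fun x => (hpos x).ne'))
        (integrable_of_continuous (cJ.log fun x => (hJ x).ne'))]
    refine integral_congr_ae (.of_forall fun x => ?_)
    simp only [← hT, hσ, T.symm_apply_apply]
    exact Real.log_div (hpos x).ne' (hJ x).ne'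
  rw [← hlog, hmap]
  exact entropy_withDensity cσ fun x => hq _

end Displacement

/-! ### Second variation along displacements of a Gibbs measure -/

theorem integrable_exp_neg {W : Torus n → ℝ} (hW : Continuous W) :
    Integrable (fun x => Real.exp (-W x)) :=
  integrable_of_continuous (by fun_prop)

theorem isProbabilityMeasure_gibbs {W : Torus n → ℝ} (hW : Continuous W) :
    IsProbabilityMeasure ((volume : Measure (Torus n)).tilted fun x => -W x) :=
  isProbabilityMeasure_tilted (integrable_exp_neg hW)

theorem entropy_gibbs {W : Torus n → ℝ} (hW : Continuous W) :
    entropy ((volume : Measure (Torus n)).tilted fun x => -W x) =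
      ((-(∫ x, W x ∂(volume : Measure (Torus n)).tilted fun x => -W x) -
        Real.log (∫ x, Real.exp (-W x)) : ℝ) : EReal) := by
  have hZ : 0 < ∫ x, Real.exp (-W x) := integral_exp_pos (integrable_exp_neg hW)
  have hprob := isProbabilityMeasure_gibbs hW
  have h := entropy_withDensity (σ := fun x => Real.exp (-W x) / ∫ x, Real.exp (-W x))
    (by fun_prop) fun x => by positivity
  refine h.trans ?_
  congr 1
  change ∫ x, _ ∂(volume : Measure (Torus n)).tilted (fun x => -W x) = _
  simp only [Real.log_div (Real.exp_pos _).ne' hZ.ne', Real.log_exp]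
  rw [integral_sub (integrable_of_continuous (by fun_prop)) (integrable_const _), integral_neg]
  simp

/-- `g` is `t ↦ ∫ W + H` along the displacement. Isolating the entropy in the conclusion lets both
players use the result, with `W = U` and `W = -V`. -/
theorem second_variation {W : Torus n → ℝ} {W₁ : Fin n → Torus n → ℝ}
    {W₂ : Fin n → Fin n → Torus n → ℝ} (hW : HasGrad W W₁) (hW₁ : ∀ i, HasGrad (W₁ i) (W₂ i))
    {M : ℝ} (hM : ∀ x, |W x| ≤ M) {p : ℝ≥0∞} (hp : (n : ℝ≥0∞) < p) {Φ : Torus n → Vec n}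
    (hΦ : IsGradientW2 p Φ) {μ : Measure (Torus n)} (hμ : μ = volume.tilted fun x => -W x) :
    Integrable (fun x => ‖Φ x‖ ^ 2) μ ∧
      ∃ (g g' : ℝ → ℝ) (d : ℝ),
        (∀ᶠ t in 𝓝 (0 : ℝ), entropy (displace t Φ μ) =
          ((g t - ∫ x, W x ∂displace t Φ μ : ℝ) : EReal)) ∧
        (∀ᶠ t in 𝓝 (0 : ℝ), HasDerivAt g (g' t) t) ∧ HasDerivAt g' d 0 ∧
        Real.exp (-(2 * M)) / (n + 1) * ∫ x, ‖Φ x‖ ^ 2 ∂μ ≤ d := by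
  have hp := continuous_proj (n := n)
  obtain ⟨φ, G, A, hφ, hG, hΦG⟩ := hΦ.exists_hasGrad ‹_›
  have cW := hW.continuous
  have cW₁ := fun i => (hW₁ i).continuous
  have cW₂ := fun i => (hW₁ i).continuous_grad
  have cG := fun i => (hG i).continuous
  have cA := fun i => (hG i).continuous_grad
  have cF := continuous_fieldOf cG
  have hZ : 0 < ∫ x, Real.exp (-W x) := integral_exp_pos (integrable_exp_neg cW)
  have hprob : IsProbabilityMeasure μ := hμ ▸ isProbabilityMeasure_gibbs cW
  have hac : μ ≪ volume := hμ ▸ tilted_absolutelyContinuous _ _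
  have hae : ∀ᵐ x ∂μ, Φ x = fieldOf G x := by
    filter_upwards [hac.ae_le hΦG] with x hx
    ext i
    exact hx i
  have hnorm : ∀ x, ‖fieldOf G x‖ ^ 2 = ∑ i, G i x ^ 2 := fun x => by
    simp [EuclideanSpace.norm_sq_eq, fieldOf]
  have hsq : (fun x => ‖Φ x‖ ^ 2) =ᵐ[μ] fun x => ∑ i, G i x ^ 2 := by
    filter_upwards [hae] with x hx
    rw [hx, hnorm]
  have hdisp : ∀ t, displace t Φ μ = μ.map fun x => x + proj (t • fieldOf G x) := fun t =>
    Measure.map_congr (hae.mono fun x hx => by simp only [hx])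
  have hint : ∀ h : Torus n → ℝ, ∫ x, h x ∂μ =
      (∫ x, Real.exp (-W x))⁻¹ * ∫ x, h x * Real.exp (-W x) := fun h => by
    rw [hμ, integral_tilted, ← integral_const_mul]
    refine integral_congr_ae (.of_forall fun x => ?_)
    simp only [smul_eq_mul]
    ring
  obtain ⟨k, hk, hk'⟩ := hasSecondDeriv_integral_log_jacobian cA μ
  have hent := eventually_entropy_map hG
    (ρ := fun x => Real.exp (-W x) / ∫ x, Real.exp (-W x)) (by fun_prop) fun x => by positivity
  -- A tilted measure is by definition the one with density `exp (-W) / Z`.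
  change ∀ᶠ t in 𝓝 (0 : ℝ), entropy (Measure.map _ (volume.tilted fun x => -W x)) =
    (((∫ x, _ ∂volume.tilted fun x => -W x) - ∫ x, _ ∂volume.tilted fun x => -W x : ℝ) : EReal)
    at hent
  simp only [← hμ] at hent
  refine ⟨(integrable_of_continuous (by fun_prop)).congr hsq.symm,
    fun t => (∫ x, W (x + proj (t • fieldOf G x)) ∂μ) +
      ((∫ x, Real.log (Real.exp (-W x) / ∫ x, Real.exp (-W x)) ∂μ) -
        ∫ x, Real.log (jacobian A t x) ∂μ),
    fun t => (∑ i, ∫ x, G i x * W₁ i (x + proj (t • fieldOf G x)) ∂μ) - k t,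
    (∑ i, ∫ x, G i x * ∑ j, G j x * W₂ i j x ∂μ) + ∫ x, ∑ i, ∑ j, A i j x * A j i x ∂μ,
    ?_, ?_, ?_, ?_⟩
  · filter_upwards [hent] with t ht
    rw [hdisp, ht, integral_map (Continuous.aemeasurable (by fun_prop)) cW.aestronglyMeasurable]
    congr 1
    ring
  · filter_upwards [hk] with t ht
    have h1 := hW.hasDerivAt_integral (μ := μ) continuous_id cF t
    simp only [id] at h1
    rw [integral_finsetSum _ fun i _ => integrable_of_continuous (by fun_prop)] at h1
    exact (h1.add (ht.const_sub _)).congr_deriv (by rw [sub_eq_add_neg]; rfl)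
  · have h1 : HasDerivAt (fun t : ℝ => ∑ i, ∫ x, G i x * W₁ i (x + proj (t • fieldOf G x)) ∂μ)
        (∑ i, ∫ x, G i x * ∑ j, G j x * W₂ i j x ∂μ) 0 := by
      refine HasDerivAt.fun_sum fun i _ => ?_
      have := (hW₁ i).hasDerivAt_integral_mul (μ := μ) (integrable_of_continuous (cG i))
        continuous_id cF 0
      simpa [fieldOf] using this
    exact (h1.sub hk').congr_deriv (by rw [sub_neg_eq_add])
  -- Both sides carry the same factor `1 / Z`, so the gap for the unnormalised weight suffices.
  · rw [integral_congr_ae hsq, ← integral_finsetSum _ fun i _ => integrable_of_continuous (by fun_prop),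
      ← integral_add (integrable_of_continuous (by fun_prop)) (integrable_of_continuous (by fun_prop)),
      hint, hint, mul_left_comm]
    refine mul_le_mul_of_nonneg_left ?_ (inv_nonneg.2 hZ.le)
    refine (hφ.spectral_gap hG hW hW₁ hM).trans_eq ?_
    refine integral_congr_ae (.of_forall fun x => ?_)
    simp only
    congr 1
    rw [add_comm]
    congr 1
    simp only [Finset.mul_sum]
    exact Finset.sum_congr rfl fun i _ => Finset.sum_congr rfl fun j _ => by ring

/-! ### Equilibria are Gibbs measures -/

theorem entropy_eq_integral_llr {μ : Measure (Torus n)} (h : entropy μ ≠ ⊤) :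
    μ ≪ volume ∧ Integrable (llr μ volume) μ ∧ entropy μ = ((∫ x, llr μ volume x ∂μ : ℝ) : EReal) := by
  unfold entropy at h ⊢
  split_ifs at h ⊢ with hc
  · exact ⟨hc.1, hc.2, rfl⟩
  · exact absurd rfl h

/-- Gibbs variational principle: the divergence of `μ` from the Gibbs measure is `∫ W dμ + H(μ) +
log Z`. Comparison with the Gibbs measure itself, where `∫ W + H = -log Z`, forces it to vanish. -/
theorem eq_gibbs_of_forall_le {W : Torus n → ℝ} (hW : Continuous W) {μ : Measure (Torus n)}
    [IsProbabilityMeasure μ] (hμ : entropy μ ≠ ⊤)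
    (hmin : ∀ μ' : Measure (Torus n), IsProbabilityMeasure μ' →
      ((∫ x, W x ∂μ : ℝ) : EReal) + entropy μ ≤ ((∫ x, W x ∂μ' : ℝ) : EReal) + entropy μ') :
    μ = volume.tilted fun x => -W x := by
  obtain ⟨hac, hint, hent⟩ := entropy_eq_integral_llr hμ
  have hprob := isProbabilityMeasure_gibbs hW
  have hexp := integrable_exp_neg hW
  have hi : Integrable (fun x => -W x) μ := integrable_of_continuous (by fun_prop)
  have h1 := hmin _ hprob
  rw [hent, entropy_gibbs hW, ← EReal.coe_add, ← EReal.coe_add, EReal.coe_le_coe_iff] at h1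
  have h2 := integral_llr_tilted_right hac hi hexp hint
  rw [integral_neg] at h2
  have hac' : μ ≪ volume.tilted fun x => -W x := hac.trans (absolutelyContinuous_tilted hexp)
  have hint' := integrable_llr_tilted_right hac hi hint hexp
  have h3 := InformationTheory.toReal_klDiv_of_measure_eq hac' (by simp)
  have h4 : (InformationTheory.klDiv μ (volume.tilted fun x => -W x)).toReal = 0 :=
    le_antisymm (by rw [h3, h2]; linarith) ENNReal.toReal_nonneg
  rw [ENNReal.toReal_eq_zero_iff] at h4
  exact InformationTheory.klDiv_eq_zero_iff.1
    (h4.resolve_right (InformationTheory.klDiv_ne_top hac' hint'))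

theorem exists_entropy_eq_coe (n : ℕ) : ∃ π : Measure (Torus n), IsProbabilityMeasure π ∧
    ∃ r : ℝ, entropy π = r :=
  ⟨_, isProbabilityMeasure_gibbs (continuous_const (y := (0 : ℝ))), _, entropy_gibbs continuous_const⟩

theorem entropy_eq_top_or (μ : Measure (Torus n)) : entropy μ = ⊤ ∨ ∃ r : ℝ, entropy μ = r := by
  unfold entropy
  split_ifs
  · exact Or.inr ⟨_, rfl⟩
  · exact Or.inl rfl

namespace IsMNE

variable {f : Torus n → Torus n → ℝ} {μ ν : Measure (Torus n)}

/-- If `H(ν) = ∞`, the payoff is `⊥` even when `H(μ) = ∞`, because `⊤ - ⊤ = ⊥` in `EReal`; a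
deviation of finite entropy would then do better. -/
theorem entropy_right_ne_top (h : IsMNE f μ ν) : entropy ν ≠ ⊤ := by
  intro htop
  obtain ⟨π, hπ, r, hr⟩ := exists_entropy_eq_coe n
  have h1 := h.le_left π hπ
  have h2 : energy f μ ν = ⊥ := by
    rw [energy, htop, sub_eq_add_neg, EReal.neg_top, EReal.add_bot]
  rw [h2, energy, hr, le_bot_iff] at h1
  rcases entropy_eq_top_or μ with hμ | ⟨s, hs⟩
  · rw [hμ, EReal.coe_add_top, EReal.top_sub_coe] at h1
    exact top_ne_bot h1
  · rw [hs, ← EReal.coe_add, ← EReal.coe_sub] at h1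
    exact EReal.coe_ne_bot _ h1

theorem entropy_left_ne_top (h : IsMNE f μ ν) : entropy μ ≠ ⊤ := by
  intro htop
  obtain ⟨π, hπ, r, hr⟩ := exists_entropy_eq_coe n
  obtain ⟨s, hs⟩ := (entropy_eq_top_or ν).resolve_left h.entropy_right_ne_top
  have h1 := h.le_right π hπ
  rw [energy, energy, htop, hr, hs, EReal.coe_add_top, EReal.top_sub_coe, ← EReal.coe_add,
    ← EReal.coe_sub, top_le_iff] at h1
  exact EReal.coe_ne_top _ h1

theorem left_eq_gibbs (h : IsMNE f μ ν) (hU : Continuous fun x => ∫ y, f x y ∂ν) :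
    μ = volume.tilted fun x => -∫ y, f x y ∂ν := by
  have := h.prob_left
  obtain ⟨s, hs⟩ := (entropy_eq_top_or ν).resolve_left h.entropy_right_ne_top
  obtain ⟨r, hr⟩ := (entropy_eq_top_or μ).resolve_left h.entropy_left_ne_top
  refine eq_gibbs_of_forall_le hU h.entropy_left_ne_top fun μ' hμ' => ?_
  have h1 := h.le_right μ' hμ'
  rcases entropy_eq_top_or μ' with ht | ⟨r', hr'⟩
  · rw [ht, EReal.coe_add_top]
    exact le_top
  · rw [energy, energy, hr, hs, hr', ← EReal.coe_add, ← EReal.coe_sub, ← EReal.coe_add,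
      ← EReal.coe_sub, EReal.coe_le_coe_iff] at h1
    rw [hr, hr', ← EReal.coe_add, ← EReal.coe_add, EReal.coe_le_coe_iff]
    linarith

/-- The second player maximises `∫ V - H`, that is, minimises `∫ (-V) + H`; the double sign keeps
the form `exp (-W)` with `W = -V`. -/
theorem right_eq_gibbs (h : IsMNE f μ ν) (hf : Continuous fun z : Torus n × Torus n => f z.1 z.2)
    (hV : Continuous fun y => ∫ x, f x y ∂μ) :
    ν = volume.tilted fun y => - -∫ x, f x y ∂μ := by
  have := h.prob_left
  have := h.prob_right
  obtain ⟨s, hs⟩ := (entropy_eq_top_or ν).resolve_left h.entropy_right_ne_top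
  obtain ⟨r, hr⟩ := (entropy_eq_top_or μ).resolve_left h.entropy_left_ne_top
  obtain ⟨C, -, hC⟩ := exists_forall_abs_le hf
  have hswap : ∀ ν' : Measure (Torus n), IsProbabilityMeasure ν' →
      ∫ x, ∫ y, f x y ∂ν' ∂μ = ∫ y, ∫ x, f x y ∂μ ∂ν' := fun ν' _ =>
    integral_integral_swap_of_bounded hf fun x y => hC (x, y)
  refine eq_gibbs_of_forall_le hV.neg h.entropy_right_ne_top fun ν' hν' => ?_
  have h1 := h.le_left ν' hν'
  rcases entropy_eq_top_or ν' with ht | ⟨s', hs'⟩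
  · rw [ht, EReal.coe_add_top]
    exact le_top
  · rw [energy, energy, hr, hs, hs', ← EReal.coe_add, ← EReal.coe_sub, ← EReal.coe_add,
      ← EReal.coe_sub, EReal.coe_le_coe_iff, hswap ν' hν', hswap ν inferInstance] at h1
    rw [hs, hs', ← EReal.coe_add, ← EReal.coe_add, EReal.coe_le_coe_iff]
    simp only [Pi.neg_apply, integral_neg]
    linarith

end IsMNE

/-! ### Averages of the payoff -/

theorem hasGrad_integral {h : Torus n → Torus n → ℝ} {k : Fin n → Torus n → Torus n → ℝ}
    (ch : Continuous fun z : Torus n × Torus n => h z.1 z.2)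
    (ck : ∀ i, Continuous fun z : Torus n × Torus n => k i z.1 z.2)
    (hk : ∀ y, HasGrad (fun x => h x y) (fun i x => k i x y)) (ν : Measure (Torus n))
    [IsFiniteMeasure ν] :
    HasGrad (fun x => ∫ y, h x y ∂ν) (fun i x => ∫ y, k i x y ∂ν) := by
  have hp := continuous_proj (n := n)
  have hcont : ∀ {h : Torus n → Torus n → ℝ}, Continuous (fun z : Torus n × Torus n => h z.1 z.2) →
      Continuous fun x => ∫ y, h x y ∂ν := fun {h} ch => by
    obtain ⟨C, -, hC⟩ := exists_forall_abs_le ch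
    exact continuous_of_dominated (bound := fun _ => C)
      (fun x => (ch.comp (Continuous.prodMk_right x)).aestronglyMeasurable)
      (fun x => .of_forall fun y => hC (x, y)) (integrable_const _)
      (.of_forall fun y => ch.comp (Continuous.prodMk_left y))
  refine ⟨hcont ch, fun i => hcont (ck i), fun x v => ?_⟩
  have := hasDerivAt_integral_of_continuousOn (μ := ν) (K := fun t y => h (x + proj (t • v)) y)
    (K' := fun t y => ∑ i, v i * k i (x + proj (t • v)) y) isOpen_univ
    (fun t _ => ch.comp (Continuous.prodMk_right (x + proj (t • v))))
    (Continuous.continuousOn (continuous_finsetSum _ fun i _ => continuous_const.mul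
      ((ck i).comp (by fun_prop : Continuous fun z : ℝ × Torus n => (x + proj (z.1 • v), z.2)))))
    (fun t _ y => (hk y).hasDerivAt x v t) (t := 0) trivial
  refine this.congr_deriv ?_
  have hki : ∀ i, Integrable (fun y => v i * k i x y) ν := fun i =>
    integrable_of_continuous (continuous_const.mul ((ck i).comp (Continuous.prodMk_right x)))
  simp only [zero_smul, proj_zero, add_zero]
  rw [integral_finsetSum _ fun i _ => hki i]
  simp only [integral_const_mul]

theorem contDiff_partialDeriv_left {h : Torus n → Torus n → ℝ} {k m : WithTop ℕ∞}
    (hh : ContDiff ℝ k fun z : Vec n × Vec n => h (proj z.1) (proj z.2)) (hmk : m + 1 ≤ k)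
    (i : Fin n) : ContDiff ℝ m fun z : Vec n × Vec n =>
      partialDeriv i (fun x => h x (proj z.2)) (proj z.1) := by
  have hd : Differentiable ℝ fun z : Vec n × Vec n => h (proj z.1) (proj z.2) :=
    (hh.of_le ((le_add_self).trans hmk)).differentiable one_ne_zero
  have he : ∀ z : Vec n × Vec n, partialDeriv i (fun x => h x (proj z.2)) (proj z.1) =
      fderiv ℝ (fun z : Vec n × Vec n => h (proj z.1) (proj z.2)) z
        (EuclideanSpace.single i 1, 0) := fun z => by
    have h1 : HasFDerivAt (fun x : Vec n => h (proj x) (proj z.2))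
        ((fderiv ℝ (fun z : Vec n × Vec n => h (proj z.1) (proj z.2)) z).comp
          (ContinuousLinearMap.inl ℝ (Vec n) (Vec n))) z.1 :=
      HasFDerivAt.comp (g := fun z : Vec n × Vec n => h (proj z.1) (proj z.2))
        (f := fun x : Vec n => (x, z.2)) z.1 (hd z).hasFDerivAt
        (hasFDerivAt_prodMk_left z.1 z.2)
    rw [partialDeriv_proj h1.differentiableAt, h1.fderiv]
    simp
  simp only [he]
  exact (hh.fderiv_right hmk).clm_apply contDiff_const

theorem continuous_of_comp_prodMap_proj {h : Torus n × Torus n → ℝ}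
    (hh : Continuous fun z : Vec n × Vec n => h (proj z.1, proj z.2)) : Continuous h :=
  (isOpenQuotientMap_proj.prodMap isOpenQuotientMap_proj).isQuotientMap.continuous_iff.2 hh

theorem hasGrad_of_contDiff_left {h : Torus n → Torus n → ℝ}
    (hh : ContDiff ℝ 1 fun z : Vec n × Vec n => h (proj z.1) (proj z.2)) (y : Torus n) :
    HasGrad (fun x => h x y) (fun i => partialDeriv i fun x => h x y) := by
  obtain ⟨y, rfl⟩ := isOpenQuotientMap_proj.surjective y
  exact hasGrad_of_contDiff (hh.comp (contDiff_prodMk_left y))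

theorem PayoffC2.exists_hasGrad {f : Torus n → Torus n → ℝ} (hf : PayoffC2 f) (ν : Measure (Torus n))
    [IsFiniteMeasure ν] : ∃ (U₁ : Fin n → Torus n → ℝ) (U₂ : Fin n → Fin n → Torus n → ℝ),
      HasGrad (fun x => ∫ y, f x y ∂ν) U₁ ∧ ∀ i, HasGrad (U₁ i) (U₂ i) := by
  have hf2 : ContDiff ℝ 2 fun z : Vec n × Vec n => f (proj z.1) (proj z.2) := hf
  have hf1 : ContDiff ℝ 1 fun z : Vec n × Vec n => f (proj z.1) (proj z.2) :=
    hf2.of_le one_le_two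
  have hp1 : ∀ i, ContDiff ℝ 1 fun z : Vec n × Vec n =>
      partialDeriv i (fun x => f x (proj z.2)) (proj z.1) := fun i =>
    contDiff_partialDeriv_left hf2 (by norm_num) i
  have hp2 : ∀ i j, ContDiff ℝ 0 fun z : Vec n × Vec n =>
      partialDeriv j (fun x => partialDeriv i (fun x => f x (proj z.2)) x) (proj z.1) :=
    fun i j => contDiff_partialDeriv_left (h := fun x y => partialDeriv i (fun x => f x y) x)
      (hp1 i) (by norm_num) j
  refine ⟨fun i x => ∫ y, partialDeriv i (fun x => f x y) x ∂ν,
    fun i j x => ∫ y, partialDeriv j (fun x => partialDeriv i (fun x => f x y) x) x ∂ν,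
    hasGrad_integral (k := fun i x y => partialDeriv i (fun x => f x y) x)
      (continuous_of_comp_prodMap_proj hf1.continuous)
      (fun i => continuous_of_comp_prodMap_proj (hp1 i).continuous)
      (fun y => hasGrad_of_contDiff_left hf1 y) ν,
    fun i => hasGrad_integral (h := fun x y => partialDeriv i (fun x => f x y) x)
      (k := fun j x y => partialDeriv j (fun x => partialDeriv i (fun x => f x y) x) x)
      (continuous_of_comp_prodMap_proj (hp1 i).continuous)
      (fun j => continuous_of_comp_prodMap_proj (hp2 i j).continuous)
      (fun y => hasGrad_of_contDiff_left (h := fun x y => partialDeriv i (fun x => f x y) x)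
        (hp1 i) y) ν⟩

theorem PayoffC2.swap {f : Torus n → Torus n → ℝ} (hf : PayoffC2 f) :
    PayoffC2 fun y x => f x y := by
  have hf2 : ContDiff ℝ 2 fun z : Vec n × Vec n => f (proj z.1) (proj z.2) := hf
  exact hf2.comp (contDiff_snd.prodMk contDiff_fst)

theorem abs_integral_le_of_forall_abs_le {h : Torus n → ℝ} {M : ℝ} (hM : ∀ x, |h x| ≤ M)
    (μ : Measure (Torus n)) [IsProbabilityMeasure μ] : |∫ x, h x ∂μ| ≤ M := by
  simpa using norm_integral_le_of_norm_le_const (μ := μ) (f := h) (.of_forall hM)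

end SpectralGap

end

/-! ### The main theorem. -/

theorem lemma3p1 (n : ℕ) (f : SpectralGap.Torus n → SpectralGap.Torus n → ℝ)
    (hf : SpectralGap.PayoffC2 f) :
    ∃ lam : ℝ, 0 < lam ∧
      ∀ μ ν : Measure (SpectralGap.Torus n), SpectralGap.IsMNE f μ ν →
      ∀ p : ℝ≥0∞, (n : ℝ≥0∞) < p →
        (∀ Φ : SpectralGap.Torus n → SpectralGap.Vec n, SpectralGap.IsGradientW2 p Φ →
          Integrable (fun x => ‖Φ x‖ ^ 2) μ ∧
          ∃ d : ℝ, SpectralGap.HasSecondDerivAt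
              (fun t => SpectralGap.energy f (SpectralGap.displace t Φ μ) ν) d 0 ∧
            lam * ∫ x, ‖Φ x‖ ^ 2 ∂μ ≤ d) ∧
        (∀ Ψ : SpectralGap.Torus n → SpectralGap.Vec n, SpectralGap.IsGradientW2 p Ψ →
          Integrable (fun y => ‖Ψ y‖ ^ 2) ν ∧
          ∃ d : ℝ, SpectralGap.HasSecondDerivAt
              (fun t => SpectralGap.energy f μ (SpectralGap.displace t Ψ ν)) d 0 ∧
            d ≤ -(lam * ∫ y, ‖Ψ y‖ ^ 2 ∂ν)) := by
  open SpectralGap in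
  have cf : Continuous fun z : Torus n × Torus n => f z.1 z.2 :=
    continuous_of_comp_prodMap_proj (ContDiff.continuous hf)
  obtain ⟨M, -, hM⟩ := SpectralGap.exists_forall_abs_le cf
  -- `M` bounds `f`, hence the averaged potentials of every equilibrium, so the constant depends
  -- only on `f`.
  refine ⟨Real.exp (-(2 * M)) / (n + 1), by positivity, fun μ ν h p hp => ?_⟩
  have hμ := h.prob_left
  have hν := h.prob_right
  obtain ⟨r, hr⟩ := (SpectralGap.entropy_eq_top_or μ).resolve_left h.entropy_left_ne_top
  obtain ⟨s, hs⟩ := (SpectralGap.entropy_eq_top_or ν).resolve_left h.entropy_right_ne_top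
  obtain ⟨U₁, U₂, hU, hU₁⟩ := hf.exists_hasGrad ν
  obtain ⟨V₁, V₂, hV, hV₁⟩ := hf.swap.exists_hasGrad μ
  constructor
  · intro Φ hΦ
    obtain ⟨hint, g, g', d, he, hg, hg', hd⟩ := SpectralGap.second_variation hU hU₁
      (fun x => SpectralGap.abs_integral_le_of_forall_abs_le (fun y => hM (x, y)) ν) hp hΦ
      (h.left_eq_gibbs hU.continuous)
    refine ⟨hint, d, ⟨fun t => g t - s, g', ?_, hg.mono fun t ht => ht.sub_const s, hg'⟩, hd⟩
    filter_upwards [he] with t ht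
    rw [SpectralGap.energy, ht, hs, ← EReal.coe_add, ← EReal.coe_sub]
    congr 1
    ring
  · intro Ψ hΨ
    obtain ⟨hint, g, g', d, he, hg, hg', hd⟩ := SpectralGap.second_variation hV.neg
      (fun i => (hV₁ i).neg) (fun y => (abs_neg _).trans_le
        (SpectralGap.abs_integral_le_of_forall_abs_le (fun x => hM (x, y)) μ)) hp hΨ
      (h.right_eq_gibbs cf hV.continuous)
    -- The payoff is `H(μ)` minus the functional minimised by the second player, which reverses the
    -- inequality.
    refine ⟨hint, -d, ⟨fun t => r - g t, fun t => -g' t, ?_, hg.mono fun t ht => ht.const_sub r,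
      hg'.neg⟩, neg_le_neg hd⟩
    filter_upwards [he] with t ht
    have hfin : IsFiniteMeasure (SpectralGap.displace t Ψ ν) := by
      unfold SpectralGap.displace
      infer_instance
    rw [SpectralGap.energy, ht, hr, ← EReal.coe_add, ← EReal.coe_sub,
      SpectralGap.integral_integral_swap_of_bounded cf fun x y => hM (x, y), integral_neg]
    congr 1
    ring
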